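/- Let $q$ be an odd prime power and let $t, m$ be positive integers with $2t\le m$. For integers $r, t'\ge 0$ and $n\ge 1$ let $s(r,n)$ be the number of symmetric $n\times n$ matrices over $\mathbb F_q$ of rank exactly $r$, and let $n_s(t',n)$ be the number of those of rank at most $t'$. Let $\mathbb F_q[\mathbf X]_1$ be the space of homogeneous linear polynomials in the $m^2$ variables $X_{ij}$, $1\le i,j\le m$. Let $A_1,\dots,A_{n_s(2t,m)}$ be the symmetric $m\times m$ matrices over $\mathbb F_q$ of rank at most $2t$, listed in some order, and let $\widehat C_{symm}(2t,m)\subseteq\mathbb F_q^{\,n_s(2t,m)}$ be the linear code $\{(f(A_1),f(A_2),\dots): f\in\mathbb F_q[\mathbf X]_1\}$. Let $P_1,\dots,P_{N}$ be representatives, one for each class and listed in some order, of the nonzero symmetric $m\times m$ matrices of rank at most $2t$ modulo multiplication by nonzero scalars (so that $N=N_s(2t,m)=\frac{n_s(2t,m)-1}{q-1}$), and let $C_{symm}(2t,m)\subseteq\mathbb F_q^{\,N}$ be the linear code $\{(f(P_1),\dots,f(P_N)): f\in\mathbb F_q[\mathbf X]_1\}$. Put $$ d = q^{m-1}n_s(2t-2,m-1)+q^{2t-1}s(2t-1,m-1)+(q^{2t-1}-q^{-1})\,s(2t,m-1).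 $$ Then the minimum distance of $\widehat C_{symm}(2t,m)$ is $(q-1)\,d$, and the minimum distance of $C_{symm}(2t,m)$ is $d$. -/

import Mathlib

namespace SymmDet

open scoped LinearAlgebra.Projectivization

/-- The space `S_m` of symmetric `m × m` matrices over `F`. -/
def symm (F : Type*) [Field F] (m : ℕ) : Submodule F (Matrix (Fin m) (Fin m) F) where
  carrier := {A | A.IsSymm}
  zero_mem' := Matrix.isSymm_zero
  add_mem' := fun hA hB => hA.add hB
  smul_mem' := fun c _ hA => hA.smul c

/-- `S(r, m)`: the symmetric `m × m` matrices of rank exactly `r`. -/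
def rankEq (F : Type*) [Field F] (r m : ℕ) : Set (symm F m) :=
  {A | (A : Matrix (Fin m) (Fin m) F).rank = r}

/-- `𝕊(t, m)`: the symmetric `m × m` matrices of rank at most `t`. -/
def rankLe (F : Type*) [Field F] (t m : ℕ) : Set (symm F m) :=
  {A | (A : Matrix (Fin m) (Fin m) F).rank ≤ t}

/-- `Det_s(t, m)`: the (rational points of the) symmetric determinantal variety, that is, the set
of points of the projective space of `S_m` that are represented by a matrix of rank at most `t`. -/
def det (F : Type*) [Field F] (t m : ℕ) : Set (ℙ F (symm F m)) :=
  {x | ∃ (A : symm F m) (hA : A ≠ 0), A ∈ rankLe F t m ∧ Projectivization.mk F A hA = x}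

/-- `s(r, m) = |S(r, m)|`. -/
noncomputable def s (F : Type*) [Field F] (r m : ℕ) : ℕ := Nat.card (rankEq F r m)

/-- `n_s(t, m) = |𝕊(t, m)|`. -/
noncomputable def ns (F : Type*) [Field F] (t m : ℕ) : ℕ := Nat.card (rankLe F t m)

/-- `N_s(t, m) = |Det_s(t, m)|`. -/
noncomputable def Ns (F : Type*) [Field F] (t m : ℕ) : ℕ := Nat.card (det F t m)

/-- `A` lists the elements of the set `X`, each exactly once. -/
def IsEnumeration {V : Type*} {n : ℕ} (A : Fin n → V) (X : Set V) : Prop :=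
  Function.Injective A ∧ Set.range A = X

/-- `P` lists representatives of the distinct points of the set `X` in the projective space
of `V`: one nonzero vector for each point. -/
def IsRepresentatives {F V : Type*} [Field F] [AddCommGroup V] [Module F V] {n : ℕ}
    (P : Fin n → V) (X : Set (ℙ F V)) : Prop :=
  ∃ hP : ∀ i, P i ≠ 0, IsEnumeration (fun i => Projectivization.mk F (P i) (hP i)) X

/-- The evaluation map `F[X]_1 → Fⁿ`, `f ↦ (f(P_1), …, f(P_n))`, where `F[X]_1` is the space of
homogeneous linear polynomials in the `m²` variables `X_{ij}`. -/
noncomputable def ev {F : Type*} [Field F] {m n : ℕ} (P : Fin n → symm F m) :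
    MvPolynomial.homogeneousSubmodule (Fin m × Fin m) F 1 →ₗ[F] (Fin n → F) where
  toFun f := fun i =>
    MvPolynomial.eval (fun ij => (P i : Matrix (Fin m) (Fin m) F) ij.1 ij.2)
      (f : MvPolynomial (Fin m × Fin m) F)
  map_add' f g := by
    funext i
    simp
  map_smul' c f := by
    funext i
    simp

/-- The linear code obtained by evaluating the homogeneous linear polynomials at `P_1, …, P_n`.
It is the code `Ĉ_symm(t, m)` if `P` enumerates `𝕊(t, m)`, and the code `C_symm(t, m)` if `P` lists
representatives of the points of `Det_s(t, m)`. -/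
noncomputable def code {F : Type*} [Field F] {m n : ℕ} (P : Fin n → symm F m) :
    Submodule F (Fin n → F) :=
  LinearMap.range (ev P)

/-- `d` is the minimum distance of the code `C`: the least Hamming distance between two distinct
codewords. In particular `C` has more than one codeword. -/
def IsMinDist {F : Type*} [Field F] [DecidableEq F] {n : ℕ} (C : Submodule F (Fin n → F))
    (d : ℕ) : Prop :=
  IsLeast {w : ℕ | ∃ c ∈ C, ∃ c' ∈ C, c ≠ c' ∧ hammingDist c c' = w} d

end SymmDet

/-!
Let `q` be the number of elements of `F` and `n = m - 1`. In odd characteristic every linear form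
on symmetric matrices is `A ↦ trace (B * A)` for a symmetric matrix `B`
(`exists_isSymm_eval_eq_trace`), and two forms give different codewords only if their difference is
given by some `B ≠ 0`. So the minimum distance is the least value over `B ≠ 0` of the number `W(B)`
of symmetric `A` of rank at most `2 * t` with `trace (B * A) ≠ 0`, divided by `q - 1` in the
projective case.

For a primitive additive character `ψ` put `Φ(B) = ∑ ψ (trace (B * A))`, the sum running over all
symmetric `A` of rank at most `2 * t`. By orthogonality, `q * W(B)` is `(q - 1) * n_s(2t, m)` minus
the sum of `Φ(c • B)` over `c ≠ 0` (`weight_eq_sum_fourier`). It is shown that `‖Φ(B)‖ ≤ s(2t, n)` for all `B ≠ 0`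
(`norm_fourier_leInd_le`), with `Φ(B) = s(2t, n)` if `B` has rank one (`fourier_leInd_border_zero`).
Counting `n_s(2t, m)` by the rank of a block (`rankLeCount_succ`) turns `n_s(2t, m) - s(2t, n)` into
`q` times the number `d` of the theorem.

To bound `Φ(B)`, make `B` diagonal, with first entry `b ≠ 0` and remaining block `B'`, and write `A`
as a block `D` with a border `v` and a corner `a`. The rank of `A` exceeds that of `D` by two if
`v` is not in the image of `D`, and otherwise by zero or one, according to whether the corner
vanishes once the border is cleared. Summing over `a` and `v` leaves only the blocks `D` of rank
exactly `2 * t`, each weighted by the Gauss sum of the quadratic form `b • D` (`fourier_border`).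
As this rank is even, the Gauss sum does not depend on `b` (`gauss_eq_gauss_of_even`). If `B' ≠ 0`,
let `b'` be a nonzero entry of `B'` and `B''` the rest of it. Replacing `b` by `-b'` and splitting
`D` in the same way, the Gauss sums cancel in pairs (`gaussFourier_border_neg`), and `Φ(B)` becomes
`q ^ (2t)` times the sum of `ψ (trace (B'' * E))` over the symmetric `E` of size `n - 1` and rank
`2t - 1` or `2t`. Its absolute value is at most
`q ^ (2t) * (s(2t - 1, n - 1) + s(2t, n - 1)) = s(2t, n)`. This last identity
(`rankCount_even`) and the value of `Φ` in rank one follow from recursions for the numbers of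
matrices of given rank and for their total Gauss sums, solved by one joint induction
(`rankCount_odd_and_gaussCount_even`).
-/

namespace SymmDet

open Matrix

/-! ### Bordered symmetric matrices -/

section Border

variable {F : Type*} {κ : Type*}

/-- The matrix with corner entry `a`, first row and first column `v`, and lower block `D`. -/
def border (a : F) (v : κ → F) (D : Matrix κ κ F) : Matrix (Unit ⊕ κ) (Unit ⊕ κ) F :=
  fromBlocks (of fun _ _ => a) (replicateRow Unit v) (replicateCol Unit v) D

theorem border_isSymm (a : F) (v : κ → F) {D : Matrix κ κ F} (hD : D.IsSymm) :
    (border a v D).IsSymm :=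
  IsSymm.fromBlocks (by ext; simp) (by ext; simp) hD

variable [Field F] [Fintype κ]

theorem border_mulVec (a : F) (v : κ → F) (D : Matrix κ κ F) (x₀ : F) (x : κ → F) :
    border a v D *ᵥ Sum.elim (fun _ => x₀) x
      = Sum.elim (fun _ => a * x₀ + v ⬝ᵥ x) (x₀ • v + D *ᵥ x) := by
  unfold border
  rw [fromBlocks_mulVec]
  ext i
  rcases i with i | i <;> simp [mulVec, dotProduct, mul_comm]

theorem dotProduct_sum_elim (x₀ y₀ : F) (x y : κ → F) :
    (Sum.elim (fun _ : Unit => x₀) x) ⬝ᵥ (Sum.elim (fun _ : Unit => y₀) y)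
      = x₀ * y₀ + x ⬝ᵥ y := by
  simp [dotProduct]

theorem dotProduct_border_mulVec (a : F) (v : κ → F) (D : Matrix κ κ F) (x₀ : F) (x : κ → F) :
    Sum.elim (fun _ => x₀) x ⬝ᵥ (border a v D *ᵥ Sum.elim (fun _ => x₀) x)
      = a * x₀ ^ 2 + 2 * x₀ * (v ⬝ᵥ x) + x ⬝ᵥ D *ᵥ x := by
  rw [border_mulVec, dotProduct_sum_elim, dotProduct_add, dotProduct_smul, dotProduct_comm x v,
    smul_eq_mul]
  ring

theorem dotProduct_mulVec_comm {D : Matrix κ κ F} (hD : D.IsSymm) (x y : κ → F) :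
    x ⬝ᵥ D *ᵥ y = y ⬝ᵥ D *ᵥ x := by
  rw [dotProduct_mulVec, ← mulVec_transpose, hD.eq, dotProduct_comm]

theorem rank_add_finrank_ker {ι : Type*} [Fintype ι] (A : Matrix ι ι F) :
    A.rank + Module.finrank F (LinearMap.ker A.mulVecLin) = Fintype.card ι := by
  have := LinearMap.finrank_range_add_finrank_ker A.mulVecLin
  rwa [Module.finrank_fintype_fun_eq_card] at this

/-- A vector outside the image of a symmetric matrix is not orthogonal to its kernel. -/
theorem exists_ker_dotProduct_ne_zero {D : Matrix κ κ F} (hD : D.IsSymm) {v : κ → F}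
    (hv : v ∉ LinearMap.range D.mulVecLin) : ∃ z, D *ᵥ z = 0 ∧ v ⬝ᵥ z ≠ 0 := by
  classical
  obtain ⟨f, hf, hle⟩ := Submodule.exists_le_ker_of_notMem hv
  have hfz : ∀ x, f x = x ⬝ᵥ (fun i => f (Pi.single i 1)) := by
    intro x
    conv_lhs => rw [← Finset.univ_sum_single x]
    rw [map_sum]
    refine Finset.sum_congr rfl fun i _ => ?_
    rw [← smul_eq_mul, ← map_smul, ← Pi.single_smul, smul_eq_mul, mul_one]
  refine ⟨fun i => f (Pi.single i 1), ?_, by rwa [← hfz]⟩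
  refine dotProduct_eq_zero_iff.mp fun w => ?_
  rw [dotProduct_comm, dotProduct_mulVec_comm hD, dotProduct_comm, ← hfz]
  exact hle ⟨w, rfl⟩

/-- A border outside the image of `D` splits off a hyperbolic plane, whatever the corner is. -/
theorem rank_border_of_notMem (a : F) {v : κ → F} {D : Matrix κ κ F} (hD : D.IsSymm)
    (hv : v ∉ LinearMap.range D.mulVecLin) : (border a v D).rank = D.rank + 2 := by
  obtain ⟨z, hz, hvz⟩ := exists_ker_dotProduct_ne_zero hD hv
  -- the kernel of the bordered matrix is the kernel of `v` as a functional on the kernel of `D`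
  let φ : Module.Dual F (LinearMap.ker D.mulVecLin) :=
    (dotProductBilin F F v) ∘ₗ (LinearMap.ker D.mulVecLin).subtype
  have hφ : φ ≠ 0 := fun h => hvz (LinearMap.congr_fun h ⟨z, hz⟩)
  have hφ1 := Module.Dual.finrank_ker_add_one_of_ne_zero hφ
  let e : LinearMap.ker φ →ₗ[F] LinearMap.ker (border a v D).mulVecLin :=
    { toFun := fun x => ⟨Sum.elim (fun _ => 0) x.1.1, by
        have h1 : v ⬝ᵥ x.1.1 = 0 := x.2
        have h2 : D *ᵥ x.1.1 = 0 := x.1.2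
        rw [LinearMap.mem_ker, mulVecLin_apply, border_mulVec, h1, h2]
        ext i; rcases i with i | i <;> simp⟩
      map_add' := fun x y => by ext i; rcases i with i | i <;> simp
      map_smul' := fun c x => by ext i; rcases i with i | i <;> simp }
  have he : Function.Bijective e := by
    constructor
    · intro x y h
      ext i
      exact congrFun (congrArg Subtype.val h) (Sum.inr i)
    · rintro ⟨y, hy⟩
      obtain ⟨y₀, y, rfl⟩ : ∃ y₀ y', y = Sum.elim (fun _ => y₀) y' :=
        ⟨y (Sum.inl ()), y ∘ Sum.inr, by ext i; rcases i with i | i <;> rfl⟩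
      rw [LinearMap.mem_ker, mulVecLin_apply, border_mulVec] at hy
      have h1 : a * y₀ + v ⬝ᵥ y = 0 := congrFun hy (Sum.inl ())
      have h2 : y₀ • v + D *ᵥ y = 0 := funext fun i => congrFun hy (Sum.inr i)
      have h3 : y₀ = 0 := by
        by_contra h0
        refine hv ⟨-(y₀⁻¹ • y), ?_⟩
        rw [mulVecLin_apply, mulVec_neg, mulVec_smul, eq_neg_of_add_eq_zero_right h2]
        simp [smul_smul, h0]
      subst h3
      exact ⟨⟨⟨y, by simpa using h2⟩, by simpa [φ] using h1⟩, rfl⟩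
  have h1 := (LinearEquiv.ofBijective e he).finrank_eq
  have h2 := rank_add_finrank_ker (border a v D)
  have h3 := rank_add_finrank_ker D
  simp only [Fintype.card_sum, Fintype.card_unit] at h2
  omega

open scoped Classical in
/-- A border `D *ᵥ u` can be cleared by a congruence, which leaves the corner `a`. -/
theorem rank_border_mulVec (a : F) (u : κ → F) {D : Matrix κ κ F} (hD : D.IsSymm) :
    (border (a + u ⬝ᵥ D *ᵥ u) (D *ᵥ u) D).rank = D.rank + if a = 0 then 0 else 1 := by
  -- the kernel of the bordered matrix, in the coordinates in which the border is cleared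
  let e : LinearMap.ker (LinearMap.mulLeft F a) × LinearMap.ker D.mulVecLin →ₗ[F]
      LinearMap.ker (border (a + u ⬝ᵥ D *ᵥ u) (D *ᵥ u) D).mulVecLin :=
    { toFun := fun x => ⟨Sum.elim (fun _ => x.1.1) (x.2.1 - x.1.1 • u), by
        have h1 : a * x.1.1 = 0 := x.1.2
        have h2 : D *ᵥ x.2.1 = 0 := x.2.2
        rw [LinearMap.mem_ker, mulVecLin_apply, border_mulVec, mulVec_sub, mulVec_smul, h2,
          dotProduct_sub, dotProduct_smul, dotProduct_comm (D *ᵥ u), dotProduct_comm (D *ᵥ u),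
          dotProduct_mulVec_comm hD x.2.1, h2, add_mul, h1]
        ext i; rcases i with i | i <;> simp [mul_comm]⟩
      map_add' := fun x y => by ext i; rcases i with i | i <;> simp [add_mul]; ring
      map_smul' := fun c x => by ext i; rcases i with i | i <;> simp [mul_sub, mul_assoc] }
  have he : Function.Bijective e := by
    constructor
    · intro x y h
      have h1 : x.1.1 = y.1.1 := congrFun (congrArg Subtype.val h) (Sum.inl ())
      have h2 : ∀ i, x.2.1 i - x.1.1 * u i = y.2.1 i - y.1.1 * u i :=
        fun i => congrFun (congrArg Subtype.val h) (Sum.inr i)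
      refine Prod.ext (Subtype.ext h1) (Subtype.ext (funext fun i => ?_))
      have := h2 i
      rw [h1] at this
      exact sub_left_injective this
    · rintro ⟨y, hy⟩
      obtain ⟨y₀, y, rfl⟩ : ∃ y₀ y', y = Sum.elim (fun _ => y₀) y' :=
        ⟨y (Sum.inl ()), y ∘ Sum.inr, by ext i; rcases i with i | i <;> rfl⟩
      rw [LinearMap.mem_ker, mulVecLin_apply, border_mulVec] at hy
      have h1 : (a + u ⬝ᵥ D *ᵥ u) * y₀ + (D *ᵥ u) ⬝ᵥ y = 0 := congrFun hy (Sum.inl ())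
      have h2 : y₀ • (D *ᵥ u) + D *ᵥ y = 0 := funext fun i => congrFun hy (Sum.inr i)
      have h3 : D *ᵥ (y + y₀ • u) = 0 := by rw [mulVec_add, mulVec_smul, add_comm, h2]
      have h4 : a * y₀ = 0 := by
        have h5 : y ⬝ᵥ D *ᵥ u = - (y₀ * (u ⬝ᵥ D *ᵥ u)) := by
          rw [dotProduct_mulVec_comm hD, eq_neg_of_add_eq_zero_right h2, dotProduct_neg,
            dotProduct_smul, smul_eq_mul]
        rw [dotProduct_comm _ y, h5] at h1
        linear_combination h1
      refine ⟨(⟨y₀, h4⟩, ⟨y + y₀ • u, h3⟩), ?_⟩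
      ext i
      rcases i with i | i <;> simp [e]
  have h1 := (LinearEquiv.ofBijective e he).finrank_eq
  have h2 := rank_add_finrank_ker (border (a + u ⬝ᵥ D *ᵥ u) (D *ᵥ u) D)
  have h3 := rank_add_finrank_ker D
  simp only [Fintype.card_sum, Fintype.card_unit, Module.finrank_prod] at h1 h2
  split_ifs with h
  · have : LinearMap.ker (LinearMap.mulLeft F a) = ⊤ := by
      ext x; simp [h]
    rw [this, finrank_top, Module.finrank_self] at h1
    omega
  · have : Module.finrank F (LinearMap.ker (LinearMap.mulLeft F a)) = 0 := by
      rw [Module.finrank_zero_iff]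
      refine ⟨fun x y => Subtype.ext ?_⟩
      have hz : ∀ z : LinearMap.ker (LinearMap.mulLeft F a), z.1 = 0 := fun z =>
        (mul_eq_zero.mp z.2).resolve_left h
      rw [hz, hz]
    rw [this] at h1
    omega

end Border

theorem exists_congr_diagonal {F : Type*} [Field F] (h2 : (2 : F) ≠ 0) {ι : Type*} [Fintype ι]
    [DecidableEq ι] {B : Matrix ι ι F} (hB : B.IsSymm) :
    ∃ P : Matrix ι ι F, IsUnit P.det ∧ ∃ w : ι → F, Pᵀ * B * P = diagonal w := by
  let _ := invertibleOfNonzero h2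
  have hs : LinearMap.IsSymm (Matrix.toLinearMap₂' F B : LinearMap.BilinForm F (ι → F)) := by
    refine ⟨fun x y => ?_⟩
    simp only [Matrix.toLinearMap₂'_apply', RingHom.id_apply]
    exact dotProduct_mulVec_comm hB x y
  obtain ⟨v, hv⟩ := LinearMap.BilinForm.exists_orthogonal_basis hs
  have hc : Module.finrank F (ι → F) = Fintype.card ι := Module.finrank_fintype_fun_eq_card F
  let v' := v.reindex ((finCongr hc).trans (Fintype.equivFin ι).symm)
  have hv' : ∀ i j, i ≠ j → v' i ⬝ᵥ B *ᵥ v' j = 0 := by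
    intro i j hij
    have := @hv (((finCongr hc).trans (Fintype.equivFin ι).symm).symm i)
      (((finCongr hc).trans (Fintype.equivFin ι).symm).symm j) (by simpa using hij)
    simpa [LinearMap.isOrthoᵢ_def, Matrix.toLinearMap₂'_apply', v'] using this
  let P := (Pi.basisFun F ι).toMatrix v'
  let : Invertible P := (Pi.basisFun F ι).invertibleToMatrix v'
  refine ⟨P, isUnit_det_of_invertible P, fun i => v' i ⬝ᵥ B *ᵥ v' i, ?_⟩
  have hP : ∀ i j, (Pᵀ * B * P) i j = v' i ⬝ᵥ B *ᵥ v' j := by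
    intro i j
    rw [Matrix.mul_assoc, mul_apply]
    simp only [dotProduct, mulVec, mul_apply, transpose_apply, P, Module.Basis.toMatrix_apply,
      Pi.basisFun_repr]
  ext i j
  rw [hP]
  rcases eq_or_ne i j with rfl | h
  · simp
  · rw [hv' i j h, diagonal_apply_ne _ h]

open scoped Classical

/-! ### Sums over symmetric matrices -/

section Sums

variable {F : Type*} [Field F] [Fintype F] {κ : Type*} [Fintype κ] [DecidableEq κ]

/-- The symmetric matrices indexed by an arbitrary type. -/
@[ext]
structure SymMat (F κ : Type*) where
  /-- The underlying matrix. -/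
  val : Matrix κ κ F
  isSymm : val.IsSymm

noncomputable instance : Fintype (SymMat F κ) :=
  have : Finite (Matrix κ κ F) := inferInstanceAs (Finite (κ → κ → F))
  have : Finite (SymMat F κ) := Finite.of_injective SymMat.val fun _ _ => SymMat.ext
  Fintype.ofFinite _

omit [Field F] [DecidableEq κ] in
theorem sum_symMat_equiv {ι M : Type*} [Fintype ι] [DecidableEq ι] [AddCommMonoid M] (e : ι ≃ κ)
    (h : Matrix ι ι F → M) :
    ∑ A : SymMat F ι, h A.1 = ∑ A : SymMat F κ, h (A.1.submatrix e e) := by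
  refine Fintype.sum_equiv
    { toFun := fun A => ⟨A.1.submatrix e.symm e.symm, A.2.submatrix _⟩
      invFun := fun A => ⟨A.1.submatrix e e, A.2.submatrix _⟩
      left_inv := fun A => SymMat.ext (by simp)
      right_inv := fun A => SymMat.ext (by simp) } _ _ fun A => by simp

omit [Field F] in
theorem sum_symMat_border {M : Type*} [AddCommMonoid M]
    (h : Matrix (Unit ⊕ κ) (Unit ⊕ κ) F → M) :
    ∑ A : SymMat F (Unit ⊕ κ), h A.1
      = ∑ D : SymMat F κ, ∑ a : F, ∑ v : κ → F, h (border a v D.1) := by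
  simp_rw [← Fintype.sum_prod_type']
  refine (Fintype.sum_equiv
    { toFun := fun x : SymMat F κ × F × (κ → F) =>
        ⟨border x.2.1 x.2.2 x.1.1, border_isSymm _ _ x.1.2⟩
      invFun := fun A => (⟨A.1.submatrix Sum.inr Sum.inr, A.2.submatrix _⟩,
        A.1 (Sum.inl ()) (Sum.inl ()), fun i => A.1 (Sum.inl ()) (Sum.inr i))
      left_inv := fun x => rfl
      right_inv := fun A => SymMat.ext (by
        ext i j
        rcases i with i | i <;> rcases j with j | j
        · rfl
        · rfl
        · exact A.2.apply _ _
        · rfl) } _ _ fun x => rfl).symm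

/-- Each vector in the image of `D` is hit equally often. -/
theorem sum_mulVec (D : Matrix κ κ F) (h : (κ → F) → ℂ) :
    (Fintype.card F : ℂ) ^ D.rank * ∑ u, h (D *ᵥ u)
      = (Fintype.card F : ℂ) ^ Fintype.card κ *
        ∑ v with v ∈ LinearMap.range D.mulVecLin, h v := by
  have hfib : ∀ v ∈ LinearMap.range D.mulVecLin,
      (Finset.univ.filter fun u => D *ᵥ u = v).card
        = Fintype.card F ^ Module.finrank F (LinearMap.ker D.mulVecLin) := by
    intro v hv
    rw [← Nat.card_eq_fintype_card (α := F), ← Module.natCard_eq_pow_finrank,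
      Nat.card_eq_fintype_card, Fintype.card_subtype]
    obtain ⟨u, rfl⟩ := hv
    refine Finset.card_bij (fun x _ => x - u) ?_ ?_ ?_
    · intro x hx
      simpa [mulVec_sub, sub_eq_zero] using (Finset.mem_filter.mp hx).2
    · intro x _ y _ hxy
      exact sub_left_injective hxy
    · intro y hy
      exact ⟨y + u, Finset.mem_filter.mpr ⟨Finset.mem_univ _, by
        simpa [mulVec_add] using (Finset.mem_filter.mp hy).2⟩, by simp⟩
  rw [← Finset.sum_fiberwise_of_maps_to (s := Finset.univ)
    (t := Finset.univ.filter fun v => v ∈ LinearMap.range D.mulVecLin)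
    (g := fun u => D *ᵥ u) (fun u _ => by simp), Finset.mul_sum, Finset.mul_sum]
  refine Finset.sum_congr rfl fun v hv => ?_
  rw [Finset.sum_congr rfl (g := fun _ => h v) (fun u hu => by rw [(Finset.mem_filter.mp hu).2]),
    Finset.sum_const, hfib v (Finset.mem_filter.mp hv).2, ← rank_add_finrank_ker D, pow_add,
    nsmul_eq_mul]
  push_cast
  ring

/-- The sum over all borders of a symmetric matrix `D`, weighted by a function of the rank. -/
theorem sum_border {D : Matrix κ κ F} (hD : D.IsSymm) (g : ℕ → ℂ) (f : F → (κ → F) → ℂ) :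
    (Fintype.card F : ℂ) ^ Fintype.card κ * ∑ a, ∑ v, g (border a v D).rank * f a v
      = (Fintype.card F : ℂ) ^ Fintype.card κ *
          (g (D.rank + 2) * ∑ v with v ∉ LinearMap.range D.mulVecLin, ∑ a, f a v)
        + (Fintype.card F : ℂ) ^ D.rank * ∑ a, g (D.rank + if a = 0 then 0 else 1) *
          ∑ u, f (a + u ⬝ᵥ D *ᵥ u) (D *ᵥ u) := by
  rw [Finset.sum_comm, ← Finset.sum_filter_add_sum_filter_not Finset.univ
    (fun v => v ∈ LinearMap.range D.mulVecLin), mul_add, add_comm, ← sum_mulVec D]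
  congr 2
  · rw [Finset.mul_sum]
    refine Finset.sum_congr rfl fun v hv => ?_
    rw [Finset.mul_sum]
    refine Finset.sum_congr rfl fun a _ => ?_
    rw [rank_border_of_notMem a hD (Finset.mem_filter.mp hv).2]
  · simp_rw [Finset.mul_sum]
    rw [Finset.sum_comm]
    conv_rhs => rw [Finset.sum_comm]
    rw [Finset.sum_comm]
    refine Finset.sum_congr rfl fun u _ => ?_
    rw [← Equiv.sum_comp (Equiv.addRight (u ⬝ᵥ D *ᵥ u))]
    refine Finset.sum_congr rfl fun a _ => ?_
    rw [Equiv.coe_addRight, rank_border_mulVec a u hD]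

theorem card_notMem_range (D : Matrix κ κ F) :
    ((Finset.univ.filter fun v => v ∉ LinearMap.range D.mulVecLin).card : ℂ)
      = (Fintype.card F : ℂ) ^ Fintype.card κ - (Fintype.card F : ℂ) ^ D.rank := by
  have hq : (Fintype.card F : ℂ) ≠ 0 := Nat.cast_ne_zero.mpr Fintype.card_ne_zero
  have h1 := sum_mulVec D fun _ => 1
  have h2 := Finset.card_filter_add_card_filter_not (s := (Finset.univ : Finset (κ → F)))
    (fun v => v ∈ LinearMap.range D.mulVecLin)
  have h3 : (Fintype.card F : ℂ) ^ D.rank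
      = (Finset.univ.filter fun v => v ∈ LinearMap.range D.mulVecLin).card := by
    simp only [Finset.sum_const, nsmul_eq_mul, mul_one, Finset.card_univ, Fintype.card_fun] at h1
    push_cast at h1
    rw [mul_comm] at h1
    exact mul_left_cancel₀ (pow_ne_zero _ hq) h1
  rw [h3, eq_sub_iff_add_eq, add_comm]
  rw [Finset.card_univ, Fintype.card_fun] at h2
  exact_mod_cast h2

/-- The corner that remains after clearing the border raises the rank by one unless it vanishes. -/
theorem sum_rank_shift (g : ℕ → ℂ) (f : F → ℂ) (r : ℕ) :
    ∑ a, g (r + if a = 0 then 0 else 1) * f a = (g r - g (r + 1)) * f 0 + g (r + 1) * ∑ a, f a := by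
  rw [← Finset.add_sum_erase _ _ (Finset.mem_univ (0 : F)),
    ← Finset.add_sum_erase _ f (Finset.mem_univ (0 : F)),
    Finset.sum_congr rfl (g := fun a => g (r + 1) * f a), ← Finset.mul_sum]
  · simp only [if_true, add_zero]
    ring
  · intro a ha
    rw [if_neg (Finset.ne_of_mem_erase ha)]

/-- Counting symmetric matrices, weighted by a function of the rank, by the rank of a block. -/
theorem sum_rank_border (g : ℕ → ℂ) :
    ∑ A : SymMat F (Unit ⊕ κ), g A.1.rank
      = ∑ D : SymMat F κ,
        ((Fintype.card F : ℂ) * ((Fintype.card F : ℂ) ^ Fintype.card κ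
            - (Fintype.card F : ℂ) ^ D.1.rank) * g (D.1.rank + 2)
          + (Fintype.card F : ℂ) ^ D.1.rank *
            (g D.1.rank + ((Fintype.card F : ℂ) - 1) * g (D.1.rank + 1))) := by
  have hq : (Fintype.card F : ℂ) ^ Fintype.card κ ≠ 0 :=
    pow_ne_zero _ (Nat.cast_ne_zero.mpr Fintype.card_ne_zero)
  rw [sum_symMat_border fun A => g A.rank]
  refine Finset.sum_congr rfl fun D _ => mul_left_cancel₀ hq ?_
  have h := sum_border D.2 g fun _ _ => 1
  simp only [mul_one] at h
  rw [h]
  simp only [Finset.sum_const, Finset.card_univ, nsmul_eq_mul, mul_one, card_notMem_range]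
  rw [sum_rank_shift g fun _ => ((Fintype.card (κ → F) : ℕ) : ℂ)]
  simp only [Finset.sum_const, Finset.card_univ, nsmul_eq_mul, Fintype.card_fun]
  push_cast
  ring

end Sums

/-! ### Quadratic Gauss sums of symmetric matrices -/

section Gauss

variable {F : Type*} [Field F] [Fintype F] {κ : Type*} [Fintype κ] [DecidableEq κ]
  (ψ : AddChar F ℂ)

/-- The Gauss sum of the quadratic form of `b • D`. -/
noncomputable def gauss (b : F) (D : Matrix κ κ F) : ℂ := ∑ w, ψ (b * (w ⬝ᵥ D *ᵥ w))

theorem gauss_zero (D : Matrix κ κ F) :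
    gauss ψ 0 D = (Fintype.card F : ℂ) ^ Fintype.card κ := by
  simp [gauss]

omit [Field F] in
theorem sum_fun_sum_unit {M : Type*} [AddCommMonoid M] (h : (Unit ⊕ κ → F) → M) :
    ∑ w, h w = ∑ x₀ : F, ∑ x : κ → F, h (Sum.elim (fun _ => x₀) x) := by
  rw [← Fintype.sum_prod_type']
  refine (Fintype.sum_equiv
    { toFun := fun x => Sum.elim (fun _ => x.1) x.2
      invFun := fun w => (w (Sum.inl ()), w ∘ Sum.inr)
      left_inv := fun x => rfl
      right_inv := fun w => by ext i; rcases i with i | i <;> rfl } _ _ fun x => rfl).symm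

variable {ψ}

omit [Fintype F] [DecidableEq κ] in
theorem addChar_sum (f : κ → F) : ψ (∑ i, f i) = ∏ i, ψ (f i) :=
  map_prod ψ.toMonoidHom (fun i => Multiplicative.ofAdd (f i)) Finset.univ

theorem sum_dotProduct (hψ : ψ.IsPrimitive) (v : κ → F) :
    ∑ x, ψ (v ⬝ᵥ x) = if v = 0 then (Fintype.card F : ℂ) ^ Fintype.card κ else 0 := by
  have h : ∀ x : κ → F, ψ (v ⬝ᵥ x) = ∏ i, ψ (x i * v i) := by
    intro x
    rw [dotProduct, addChar_sum]
    simp_rw [mul_comm]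
  simp_rw [h]
  rw [← Fintype.prod_sum fun i y => ψ (y * v i)]
  simp_rw [AddChar.sum_mulShift _ hψ]
  split_ifs with hv
  · simp [hv]
  · obtain ⟨i, hi⟩ := Function.ne_iff.mp hv
    exact Finset.prod_eq_zero (Finset.mem_univ i) (by simpa using hi)

/-- If `v` is not in the image of `D`, then the border `v` makes a hyperbolic plane split off, and
only the vectors with first coordinate zero contribute. -/
theorem gauss_border_of_notMem (h2 : (2 : F) ≠ 0) (hψ : ψ.IsPrimitive) {b : F} (hb : b ≠ 0) (a : F)
    {v : κ → F} {D : Matrix κ κ F} (hD : D.IsSymm) (hv : v ∉ LinearMap.range D.mulVecLin) :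
    gauss ψ b (border a v D) = gauss ψ b D := by
  obtain ⟨z, hz, hvz⟩ := exists_ker_dotProduct_ne_zero hD hv
  have key : ∀ x₀ : F, x₀ ≠ 0 → ∑ x : κ → F, ψ (b * (a * x₀ ^ 2 + 2 * x₀ * (v ⬝ᵥ x) + x ⬝ᵥ D *ᵥ x))
      = 0 := by
    intro x₀ hx₀
    obtain ⟨s, hs⟩ : ∃ s, ψ s ≠ 1 := by
      by_contra! h
      exact hψ one_ne_zero (by ext; simp [h])
    -- translation by a multiple of `z` multiplies the sum by `ψ s`
    have hshift := Equiv.sum_comp (Equiv.addRight ((s / (b * (2 * x₀) * (v ⬝ᵥ z))) • z))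
      (fun x : κ → F => ψ (b * (a * x₀ ^ 2 + 2 * x₀ * (v ⬝ᵥ x) + x ⬝ᵥ D *ᵥ x)))
    have hterm : ∀ x : κ → F, ψ (b * (a * x₀ ^ 2
        + 2 * x₀ * (v ⬝ᵥ (x + (s / (b * (2 * x₀) * (v ⬝ᵥ z))) • z))
        + (x + (s / (b * (2 * x₀) * (v ⬝ᵥ z))) • z) ⬝ᵥ
            D *ᵥ (x + (s / (b * (2 * x₀) * (v ⬝ᵥ z))) • z)))
        = ψ s * ψ (b * (a * x₀ ^ 2 + 2 * x₀ * (v ⬝ᵥ x) + x ⬝ᵥ D *ᵥ x)) := by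
      intro x
      rw [← AddChar.map_add_eq_mul, mulVec_add, mulVec_smul, hz, smul_zero, add_zero,
        add_dotProduct, smul_dotProduct, dotProduct_mulVec_comm hD z x, hz, dotProduct_zero,
        smul_zero, add_zero, dotProduct_add, dotProduct_smul, smul_eq_mul]
      congr 1
      field_simp
      ring
    simp only [Equiv.coe_addRight, hterm] at hshift
    rw [← Finset.mul_sum] at hshift
    by_contra h0
    exact hs (mul_right_cancel₀ h0 (hshift.trans (one_mul _).symm))
  unfold gauss
  rw [sum_fun_sum_unit]
  simp_rw [dotProduct_border_mulVec]
  rw [Finset.sum_eq_single 0 (fun x₀ _ h => key x₀ h) (by simp)]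
  simp

theorem gauss_border_mulVec (b a : F) (u : κ → F) {D : Matrix κ κ F} (hD : D.IsSymm) :
    gauss ψ b (border (a + u ⬝ᵥ D *ᵥ u) (D *ᵥ u) D) = (∑ x, ψ (b * a * x ^ 2)) * gauss ψ b D := by
  unfold gauss
  rw [sum_fun_sum_unit, Finset.sum_mul]
  refine Finset.sum_congr rfl fun x₀ _ => ?_
  rw [← Equiv.sum_comp (Equiv.addRight (x₀ • u)) (fun w => ψ (b * (w ⬝ᵥ D *ᵥ w))), Finset.mul_sum]
  refine Finset.sum_congr rfl fun x _ => ?_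
  rw [dotProduct_border_mulVec, ← AddChar.map_add_eq_mul, Equiv.coe_addRight, mulVec_add,
    mulVec_smul, add_dotProduct, dotProduct_add, dotProduct_add, smul_dotProduct, smul_dotProduct,
    dotProduct_smul, dotProduct_smul, dotProduct_mulVec_comm hD u x, dotProduct_comm _ x]
  congr 1
  simp only [smul_eq_mul]
  ring

/-- The product of the Gauss sums of `b • D` and `-b • D` depends on the rank of `D` only. -/
theorem gauss_mul_gauss_neg (h2 : (2 : F) ≠ 0) (hψ : ψ.IsPrimitive) {b : F} (hb : b ≠ 0)
    {D : Matrix κ κ F} (hD : D.IsSymm) :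
    (Fintype.card F : ℂ) ^ D.rank * (gauss ψ (-b) D * gauss ψ b D)
      = (Fintype.card F : ℂ) ^ Fintype.card κ * (Fintype.card F : ℂ) ^ Fintype.card κ := by
  have hexp : gauss ψ (-b) D * gauss ψ b D
      = ∑ z, ψ (b * (z ⬝ᵥ D *ᵥ z)) * ∑ x, ψ (((2 * b) • (D *ᵥ z)) ⬝ᵥ x) := by
    unfold gauss
    rw [Finset.sum_mul_sum]
    simp_rw [Finset.mul_sum]
    conv_rhs => rw [Finset.sum_comm]
    refine Finset.sum_congr rfl fun x _ => ?_
    -- substitute `y = x + z` in the second sum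
    rw [← Equiv.sum_comp (Equiv.addLeft x)]
    refine Finset.sum_congr rfl fun z _ => ?_
    rw [← AddChar.map_add_eq_mul, ← AddChar.map_add_eq_mul, Equiv.coe_addLeft, mulVec_add,
      add_dotProduct, dotProduct_add, dotProduct_add, dotProduct_mulVec_comm hD x z,
      smul_dotProduct, dotProduct_comm _ x, dotProduct_mulVec_comm hD x z]
    congr 1
    simp only [smul_eq_mul]
    ring
  have hterm : ∀ z, ψ (b * (z ⬝ᵥ D *ᵥ z)) * ∑ x, ψ (((2 * b) • (D *ᵥ z)) ⬝ᵥ x)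
      = if D *ᵥ z = 0 then (Fintype.card F : ℂ) ^ Fintype.card κ else 0 := by
    intro z
    rw [sum_dotProduct hψ]
    by_cases hz : D *ᵥ z = 0
    · simp [hz]
    · simp [hz, h2, hb]
  rw [hexp, Finset.sum_congr rfl fun z _ => hterm z,
    sum_mulVec D fun v => if v = 0 then (Fintype.card F : ℂ) ^ Fintype.card κ else 0]
  congr 1
  rw [Finset.sum_ite_eq_of_mem']
  simpa using ⟨0, mulVec_zero D⟩

end Gauss

section GaussEven

variable {F : Type*} [Field F] [Fintype F] {κ : Type*} [Fintype κ] [DecidableEq κ]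
  {ψ : AddChar F ℂ}

/-- The Gauss sum of a unary form is the quadratic Gauss sum up to a quadratic character. -/
theorem sum_addChar_mul_sq (h2 : (2 : F) ≠ 0) (hψ : ψ.IsPrimitive) {b : F} (hb : b ≠ 0) :
    ∑ x, ψ (b * x ^ 2) = (quadraticChar F b : ℂ) * ∑ y, (quadraticChar F y : ℂ) * ψ y := by
  have hF : ringChar F ≠ 2 := fun h => h2 (by
    have := ringChar.Nat.cast_ringChar (R := F)
    rw [h] at this
    exact_mod_cast this)
  have h1 : ∑ x, ψ (b * x ^ 2) = ∑ y, ((quadraticChar F y : ℂ) + 1) * ψ (b * y) := by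
    rw [← Finset.sum_fiberwise (s := Finset.univ) (g := fun x : F => x ^ 2)]
    refine Finset.sum_congr rfl fun y _ => ?_
    rw [Finset.sum_congr rfl (g := fun _ => ψ (b * y))
      (fun x hx => by rw [(Finset.mem_filter.mp hx).2]), Finset.sum_const, nsmul_eq_mul]
    congr 1
    have := quadraticChar_card_sqrts hF y
    rw [Set.toFinset_ofPred] at this
    exact_mod_cast this
  have h3 : ∑ y, ψ (b * y) = 0 := by
    simp_rw [mul_comm b]
    rw [AddChar.sum_mulShift _ hψ, if_neg hb]
    simp
  simp_rw [h1, add_mul, one_mul]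
  rw [Finset.sum_add_distrib, h3, add_zero, ← Equiv.sum_comp (Equiv.mulLeft₀ b⁻¹ (inv_ne_zero hb)),
    Finset.mul_sum]
  refine Finset.sum_congr rfl fun y _ => ?_
  have hχ : quadraticChar F b⁻¹ = quadraticChar F b := by
    have hu := quadraticChar_sq_one hb
    have hm : quadraticChar F b * quadraticChar F b⁻¹ = 1 := by
      rw [← map_mul, mul_inv_cancel₀ hb, map_one]
    calc quadraticChar F b⁻¹ = quadraticChar F b ^ 2 * quadraticChar F b⁻¹ := by rw [hu, one_mul]
      _ = quadraticChar F b := by rw [sq, mul_assoc, hm, mul_one]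
  rw [Equiv.mulLeft₀_apply, mul_inv_cancel_left₀ hb, map_mul, hχ]
  push_cast
  ring

theorem gauss_congr (b : F) (D : Matrix κ κ F) {P : Matrix κ κ F} (hP : IsUnit P.det) :
    gauss ψ b (Pᵀ * D * P) = gauss ψ b D := by
  have hinj : Function.Bijective P.mulVec := by
    rw [← Finite.injective_iff_bijective, mulVec_injective_iff_isUnit]
    exact (isUnit_iff_isUnit_det P).mpr hP
  refine Fintype.sum_bijective _ hinj _ _ fun w => ?_
  congr 2
  rw [Matrix.mul_assoc, ← mulVec_mulVec, ← mulVec_mulVec, dotProduct_mulVec, vecMul_transpose]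

theorem gauss_diagonal (b : F) (w : κ → F) :
    gauss ψ b (diagonal w) = ∏ i, ∑ x, ψ (b * w i * x ^ 2) := by
  rw [Fintype.prod_sum fun i x => ψ (b * w i * x ^ 2)]
  refine Finset.sum_congr rfl fun x _ => ?_
  rw [← addChar_sum, dotProduct, Finset.mul_sum]
  congr 1
  refine Finset.sum_congr rfl fun i _ => ?_
  rw [mulVec_diagonal]
  ring

omit [Fintype F] in
theorem rank_congr (D : Matrix κ κ F) {P : Matrix κ κ F} (hP : IsUnit P.det) :
    (Pᵀ * D * P).rank = D.rank := by
  rw [rank_mul_eq_left_of_isUnit_det _ _ hP,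
    rank_mul_eq_right_of_isUnit_det _ _ (by rwa [det_transpose])]

/-- For a form of even rank the quadratic character of the scalar cancels. -/
theorem gauss_eq_gauss_of_even (h2 : (2 : F) ≠ 0) (hψ : ψ.IsPrimitive) {b c : F} (hb : b ≠ 0)
    (hc : c ≠ 0) {D : Matrix κ κ F} (hD : D.IsSymm) (hr : Even D.rank) :
    gauss ψ b D = gauss ψ c D := by
  obtain ⟨P, hP, w, hw⟩ := exists_congr_diagonal h2 hD
  rw [← rank_congr D hP, hw, rank_diagonal, Fintype.card_subtype] at hr
  have key : ∀ b : F, b ≠ 0 → gauss ψ b D = ∏ i, ∑ x, ψ (w i * x ^ 2) := by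
    intro b hb
    rw [← gauss_congr b D hP, hw, gauss_diagonal]
    have hi : ∀ i, ∑ x, ψ (b * w i * x ^ 2)
        = (if w i ≠ 0 then (quadraticChar F b : ℂ) else 1) * ∑ x, ψ (w i * x ^ 2) := by
      intro i
      by_cases h : w i = 0
      · simp [h]
      · rw [if_pos h, sum_addChar_mul_sq h2 hψ (mul_ne_zero hb h), sum_addChar_mul_sq h2 hψ h,
          map_mul]
        push_cast
        ring
    simp_rw [hi]
    rw [Finset.prod_mul_distrib, Finset.prod_ite, Finset.prod_const, Finset.prod_const_one, mul_one]
    obtain ⟨k, hk⟩ := hr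
    rw [hk, ← two_mul, pow_mul]
    have : (quadraticChar F b : ℂ) ^ 2 = 1 := by exact_mod_cast quadraticChar_sq_one hb
    rw [this, one_pow, one_mul]
  rw [key b hb, key c hc]

end GaussEven

/-! ### Fourier transforms of rank functions -/

section Fourier

variable {F : Type*} [Field F] [Fintype F] {κ : Type*} [Fintype κ] [DecidableEq κ]
  (ψ : AddChar F ℂ)

/-- The Fourier transform at `B` of the function `g ∘ rank` on symmetric matrices. -/
noncomputable def fourier (g : ℕ → ℂ) (B : Matrix κ κ F) : ℂ :=
  ∑ A : SymMat F κ, g A.1.rank * ψ (trace (B * A.1))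

/-- The Fourier transform at `B` of the function `g ∘ rank` on symmetric matrices, twisted by
Gauss sums. -/
noncomputable def gaussFourier (g : ℕ → ℂ) (b : F) (B : Matrix κ κ F) : ℂ :=
  ∑ A : SymMat F κ, g A.1.rank * (ψ (trace (B * A.1)) * gauss ψ b A.1)

omit [Fintype F] [DecidableEq κ] in
theorem trace_border_mul_border (b a : F) (v : κ → F) (B D : Matrix κ κ F) :
    trace (border b 0 B * border a v D) = b * a + trace (B * D) := by
  unfold border
  rw [fromBlocks_multiply]
  simp [trace, mul_apply]

theorem fourier_congr (g : ℕ → ℂ) (B : Matrix κ κ F) {P : Matrix κ κ F} (hP : IsUnit P.det) :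
    fourier ψ g (Pᵀ * B * P) = fourier ψ g B := by
  have hP' : IsUnit Pᵀ.det := by rwa [det_transpose]
  refine Fintype.sum_bijective
    (fun A : SymMat F κ => (⟨P * A.1 * Pᵀ, by
      rw [Matrix.IsSymm, transpose_mul, transpose_mul, transpose_transpose, A.2.eq,
        Matrix.mul_assoc]⟩ : SymMat F κ)) ?_ _ _ fun A => ?_
  · rw [← Finite.injective_iff_bijective]
    intro A B h
    have h' : P * A.1 * Pᵀ = P * B.1 * Pᵀ := congrArg SymMat.val h
    have hu := (isUnit_iff_isUnit_det P).mpr hP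
    have hu' := (isUnit_iff_isUnit_det Pᵀ).mpr hP'
    exact SymMat.ext (hu.mul_left_cancel (hu'.mul_right_cancel h'))
  · have hr := rank_congr A.1 hP'
    rw [transpose_transpose] at hr
    simp only
    rw [hr, Matrix.mul_assoc, Matrix.mul_assoc, trace_mul_comm]
    simp only [Matrix.mul_assoc]

omit [Fintype F] [DecidableEq κ] in
theorem trace_submatrix_mul {ι : Type*} [Fintype ι] (e : ι ≃ κ) (B : Matrix κ κ F)
    (A : Matrix ι ι F) : trace (B.submatrix e e * A) = trace (B * A.submatrix e.symm e.symm) := by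
  have h : B.submatrix e e * A = (B * A.submatrix e.symm e.symm).submatrix e e := by
    rw [← submatrix_mul_equiv B _ e e e, submatrix_submatrix]
    simp
  rw [h]
  exact Equiv.sum_comp e fun i => (B * A.submatrix e.symm e.symm) i i

theorem fourier_submatrix {ι : Type*} [Fintype ι] [DecidableEq ι] (e : ι ≃ κ) (g : ℕ → ℂ)
    (B : Matrix κ κ F) : fourier ψ g (B.submatrix e e) = fourier ψ g B := by
  unfold fourier
  rw [sum_symMat_equiv e.symm fun A => g A.rank * ψ (trace (B * A))]
  refine Finset.sum_congr rfl fun A _ => ?_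
  rw [rank_submatrix, trace_submatrix_mul]

variable {ψ}

omit [DecidableEq κ] in
theorem norm_fourier_le (g : ℕ → ℝ) (hg : ∀ r, 0 ≤ g r) (B : Matrix κ κ F) :
    ‖fourier ψ (fun r => g r) B‖ ≤ ∑ A : SymMat F κ, g A.1.rank := by
  refine (norm_sum_le _ _).trans (Finset.sum_le_sum fun A _ => ?_)
  rw [norm_mul, AddChar.norm_apply, mul_one, Complex.norm_real, Real.norm_of_nonneg (hg _)]

/-- The sum over the corner entry kills all borders that leave it unconstrained; only the ranks at
which `g` jumps survive. -/
theorem fourier_border (hψ : ψ.IsPrimitive) (g : ℕ → ℂ) {b : F} (hb : b ≠ 0) (B : Matrix κ κ F) :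
    (Fintype.card F : ℂ) ^ Fintype.card κ * fourier ψ g (border b 0 B)
      = gaussFourier ψ (fun r => (Fintype.card F : ℂ) ^ r * (g r - g (r + 1))) b B := by
  have hsum : ∑ a, ψ (b * a) = 0 := by
    simp_rw [mul_comm b]
    rw [AddChar.sum_mulShift _ hψ, if_neg hb, Nat.cast_zero]
  unfold fourier gaussFourier
  rw [sum_symMat_border fun A => g A.rank * ψ (trace (border b 0 B * A)), Finset.mul_sum]
  refine Finset.sum_congr rfl fun D _ => ?_
  simp_rw [trace_border_mul_border, AddChar.map_add_eq_mul]
  rw [sum_border D.2 g fun a _ => ψ (b * a) * ψ (trace (B * D.1))]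
  rw [Finset.sum_eq_zero fun v _ => by rw [← Finset.sum_mul, hsum, zero_mul], mul_zero, mul_zero,
    zero_add]
  have h : ∀ a : F, ∑ u : κ → F, ψ (b * (a + u ⬝ᵥ D.1 *ᵥ u)) * ψ (trace (B * D.1))
      = ψ (b * a) * (ψ (trace (B * D.1)) * gauss ψ b D.1) := by
    intro a
    rw [gauss, Finset.mul_sum, Finset.mul_sum]
    refine Finset.sum_congr rfl fun u _ => ?_
    rw [mul_add, AddChar.map_add_eq_mul]
    ring
  simp_rw [h]
  rw [sum_rank_shift g, ← Finset.sum_mul, hsum]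
  simp only [mul_zero, AddChar.map_zero_eq_one]
  ring

/-- The contribution of a fixed block `D` to the twisted Fourier transform at `border c 0 B`, up to
the factor depending on `B` alone. -/
theorem gaussFourier_border_summand (h2 : (2 : F) ≠ 0) (hψ : ψ.IsPrimitive) (g : ℕ → ℂ) {b : F}
    (hb : b ≠ 0) (c : F) {D : Matrix κ κ F} (hD : D.IsSymm) :
    (Fintype.card F : ℂ) ^ Fintype.card κ *
        ∑ a, ∑ v, g (border a v D).rank * (ψ (c * a) * gauss ψ b (border a v D))
      = (Fintype.card F : ℂ) ^ Fintype.card κ * (g (D.rank + 2)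
          * (((Fintype.card F : ℂ) ^ Fintype.card κ - (Fintype.card F : ℂ) ^ D.rank)
            * ((∑ a, ψ (c * a)) * gauss ψ b D)))
        + (Fintype.card F : ℂ) ^ D.rank * ((g D.rank - g (D.rank + 1)) * Fintype.card F
            + g (D.rank + 1) * ∑ a, ψ (c * a) * ∑ x, ψ (b * a * x ^ 2))
          * (gauss ψ c D * gauss ψ b D) := by
  rw [sum_border hD g fun a v => ψ (c * a) * gauss ψ b (border a v D)]
  congr 1
  · rw [Finset.sum_congr rfl (g := fun _ => (∑ a, ψ (c * a)) * gauss ψ b D), Finset.sum_const,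
      nsmul_eq_mul, card_notMem_range]
    intro v hv
    rw [Finset.sum_mul]
    refine Finset.sum_congr rfl fun a _ => ?_
    rw [gauss_border_of_notMem h2 hψ hb a hD (Finset.mem_filter.mp hv).2]
  · have h : ∀ a : F, ∑ u : κ → F, ψ (c * (a + u ⬝ᵥ D *ᵥ u))
          * gauss ψ b (border (a + u ⬝ᵥ D *ᵥ u) (D *ᵥ u) D)
        = (ψ (c * a) * ∑ x, ψ (b * a * x ^ 2)) * (gauss ψ c D * gauss ψ b D) := by
      intro a
      simp_rw [gauss_border_mulVec b a _ hD]
      generalize ∑ x, ψ (b * a * x ^ 2) = S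
      generalize gauss ψ b D = G
      rw [gauss, Finset.sum_mul, Finset.mul_sum]
      refine Finset.sum_congr rfl fun u _ => ?_
      rw [mul_add, AddChar.map_add_eq_mul]
      ring
    simp_rw [h]
    rw [sum_rank_shift g, ← Finset.sum_mul]
    simp
    ring

theorem sum_addChar_mul_sum_sq (hψ : ψ.IsPrimitive) (b c : F) :
    ∑ a, ψ (c * a) * ∑ x, ψ (b * a * x ^ 2)
      = (Fintype.card F : ℂ) * (Finset.univ.filter fun x => c + b * x ^ 2 = 0).card := by
  have h : ∀ x : F, ∑ a, ψ (c * a) * ψ (b * a * x ^ 2)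
      = if c + b * x ^ 2 = 0 then (Fintype.card F : ℂ) else 0 := by
    intro x
    have := AddChar.sum_mulShift (c + b * x ^ 2) hψ
    rw [Nat.cast_ite, Nat.cast_zero] at this
    rw [← this]
    refine Finset.sum_congr rfl fun a _ => ?_
    rw [← AddChar.map_add_eq_mul]
    congr 1
    ring
  simp_rw [Finset.mul_sum]
  rw [Finset.sum_comm]
  simp_rw [h]
  rw [← Finset.sum_filter, Finset.sum_const, nsmul_eq_mul, mul_comm]

/-- If the diagonal entry split off from `B` is the negative of the scalar of the Gauss sums, then
the Gauss sums cancel, and an untwisted Fourier transform of a nonnegative function remains. -/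
theorem gaussFourier_border_neg (h2 : (2 : F) ≠ 0) (hψ : ψ.IsPrimitive) (g : ℕ → ℂ) {b : F}
    (hb : b ≠ 0) (B : Matrix κ κ F) :
    gaussFourier ψ g b (border (-b) 0 B)
      = (Fintype.card F : ℂ) ^ (Fintype.card κ + 1) * fourier ψ (fun r => g r + g (r + 1)) B := by
  have hq : (Fintype.card F : ℂ) ^ Fintype.card κ ≠ 0 :=
    pow_ne_zero _ (Nat.cast_ne_zero.mpr Fintype.card_ne_zero)
  have hsum : ∑ a, ψ (-b * a) = 0 := by
    simp_rw [mul_comm (-b)]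
    rw [AddChar.sum_mulShift _ hψ, if_neg (neg_ne_zero.mpr hb), Nat.cast_zero]
  have hcard : (Finset.univ.filter fun x : F => -b + b * x ^ 2 = 0).card = 2 := by
    have : (Finset.univ.filter fun x : F => -b + b * x ^ 2 = 0) = {1, -1} := by
      ext x
      have : -b + b * x ^ 2 = b * ((x - 1) * (x - -1)) := by ring
      simp only [Finset.mem_filter, Finset.mem_univ, true_and, this, mul_eq_zero, hb, false_or,
        sub_eq_zero, Finset.mem_insert, Finset.mem_singleton]
    rw [this, Finset.card_pair]
    intro h
    exact h2 (by linear_combination h)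
  unfold fourier gaussFourier
  rw [sum_symMat_border fun A => g A.rank * (ψ (trace (border (-b) 0 B * A)) * gauss ψ b A),
    Finset.mul_sum]
  refine Finset.sum_congr rfl fun D _ => mul_left_cancel₀ hq ?_
  have h := gaussFourier_border_summand h2 hψ g hb (-b) D.2
  rw [hsum, sum_addChar_mul_sum_sq hψ, hcard] at h
  have hn := gauss_mul_gauss_neg h2 hψ hb D.2
  simp_rw [trace_border_mul_border, AddChar.map_add_eq_mul]
  calc _ = ψ (trace (B * D.1)) * ((Fintype.card F : ℂ) ^ Fintype.card κ *
        ∑ a, ∑ v, g (border a v D.1).rank * (ψ (-b * a) * gauss ψ b (border a v D.1))) := by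
        simp_rw [Finset.mul_sum]
        refine Finset.sum_congr rfl fun a _ => Finset.sum_congr rfl fun v _ => ?_
        ring
    _ = _ := by
        rw [h]
        push_cast
        linear_combination ψ (trace (B * D.1)) * (g D.1.rank + g (D.1.rank + 1))
          * (Fintype.card F : ℂ) * hn

theorem gaussFourier_border_zero (h2 : (2 : F) ≠ 0) (hψ : ψ.IsPrimitive) (g : ℕ → ℂ) {b : F}
    (hb : b ≠ 0) :
    gaussFourier ψ g b (0 : Matrix (Unit ⊕ κ) (Unit ⊕ κ) F)
      = gaussFourier ψ (fun r => (Fintype.card F : ℂ) * ((Fintype.card F : ℂ) ^ Fintype.card κ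
          - (Fintype.card F : ℂ) ^ r) * g (r + 2) + (Fintype.card F : ℂ) ^ (r + 1) * g r) b
        (0 : Matrix κ κ F) := by
  have hq : (Fintype.card F : ℂ) ^ Fintype.card κ ≠ 0 :=
    pow_ne_zero _ (Nat.cast_ne_zero.mpr Fintype.card_ne_zero)
  have hcard : (Finset.univ.filter fun x : F => 0 + b * x ^ 2 = 0).card = 1 := by
    have : (Finset.univ.filter fun x : F => 0 + b * x ^ 2 = 0) = {0} := by
      ext x
      simp [hb]
    rw [this, Finset.card_singleton]
  unfold gaussFourier
  rw [sum_symMat_border fun A => g A.rank * (ψ (trace (0 * A)) * gauss ψ b A)]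
  refine Finset.sum_congr rfl fun D _ => mul_left_cancel₀ hq ?_
  have h := gaussFourier_border_summand h2 hψ g hb 0 D.2
  rw [sum_addChar_mul_sum_sq hψ, hcard, gauss_zero] at h
  simp only [zero_mul, AddChar.map_zero_eq_one, Finset.sum_const, Finset.card_univ, nsmul_eq_mul,
    mul_one, one_mul] at h
  simp only [Matrix.zero_mul, trace_zero, AddChar.map_zero_eq_one, one_mul]
  rw [h]
  push_cast
  ring

end Fourier

/-! ### Rank counts and the maximal Fourier coefficient -/

section Count

variable {F : Type*} [Field F] [Fintype F]

/-- The number of symmetric matrices of rank `r`. -/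
noncomputable def rankCount (F κ : Type*) [Field F] [Fintype F] [Fintype κ] (r : ℕ) : ℕ :=
  (Finset.univ.filter fun A : SymMat F κ => A.1.rank = r).card

variable {κ : Type*} [Fintype κ] {ι : Type*} [Fintype ι]

theorem sum_rank_equiv {M : Type*} [AddCommMonoid M] (e : ι ≃ κ) (g : ℕ → M) :
    ∑ A : SymMat F ι, g A.1.rank = ∑ A : SymMat F κ, g A.1.rank := by
  rw [sum_symMat_equiv e fun A => g A.rank]
  exact Finset.sum_congr rfl fun A _ => by rw [rank_submatrix]

theorem rankCount_equiv (e : ι ≃ κ) (r : ℕ) : rankCount F ι r = rankCount F κ r := by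
  unfold rankCount
  rw [Finset.card_filter, Finset.card_filter]
  exact sum_rank_equiv e fun k => if k = r then 1 else 0

theorem sum_mul_ite_rank (h : ℕ → ℂ) (k : ℕ) :
    ∑ A : SymMat F κ, h A.1.rank * (if A.1.rank = k then 1 else 0) = h k * rankCount F κ k := by
  unfold rankCount
  simp_rw [mul_ite, mul_one, mul_zero]
  rw [← Finset.sum_filter, Finset.sum_congr rfl (g := fun _ => h k), Finset.sum_const, nsmul_eq_mul,
    mul_comm]
  intro A hA
  rw [(Finset.mem_filter.mp hA).2]

theorem cast_rankCount (k : ℕ) :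
    (rankCount F κ k : ℂ) = ∑ A : SymMat F κ, if A.1.rank = k then 1 else 0 := by
  simpa using (sum_mul_ite_rank (F := F) (κ := κ) (fun _ => 1) k).symm

variable [DecidableEq κ] [DecidableEq ι]

theorem rankCount_border_zero : (rankCount F (Unit ⊕ κ) 0 : ℂ) = rankCount F κ 0 := by
  rw [cast_rankCount, sum_rank_border fun r => if r = 0 then (1 : ℂ) else 0]
  simp_rw [Nat.add_eq_zero_iff]
  simpa using sum_mul_ite_rank (F := F) (κ := κ) (fun r => (Fintype.card F : ℂ) ^ r) 0

theorem rankCount_border_one : (rankCount F (Unit ⊕ κ) 1 : ℂ)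
    = Fintype.card F * rankCount F κ 1 + ((Fintype.card F : ℂ) - 1) * rankCount F κ 0 := by
  have h0 := sum_mul_ite_rank (F := F) (κ := κ)
    (fun r => (Fintype.card F : ℂ) ^ r * ((Fintype.card F : ℂ) - 1)) 0
  have h1 := sum_mul_ite_rank (F := F) (κ := κ) (fun r => (Fintype.card F : ℂ) ^ r) 1
  simp only [pow_zero, one_mul, pow_one] at h0 h1
  rw [cast_rankCount, sum_rank_border fun r => if r = 1 then (1 : ℂ) else 0, ← h0, ← h1,
    ← Finset.sum_add_distrib]
  refine Finset.sum_congr rfl fun D _ => ?_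
  simp only [Nat.add_eq_right, show D.1.rank + 2 ≠ 1 by omega, if_false]
  ring

theorem rankCount_border_add_two (k : ℕ) : (rankCount F (Unit ⊕ κ) (k + 2) : ℂ)
    = (Fintype.card F : ℂ) * ((Fintype.card F : ℂ) ^ Fintype.card κ - (Fintype.card F : ℂ) ^ k)
        * rankCount F κ k
      + (Fintype.card F : ℂ) ^ (k + 1) * ((Fintype.card F : ℂ) - 1) * rankCount F κ (k + 1)
      + (Fintype.card F : ℂ) ^ (k + 2) * rankCount F κ (k + 2) := by
  rw [cast_rankCount, sum_rank_border fun r => if r = k + 2 then (1 : ℂ) else 0,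
    ← sum_mul_ite_rank (fun r => (Fintype.card F : ℂ) * ((Fintype.card F : ℂ) ^ Fintype.card κ
      - (Fintype.card F : ℂ) ^ r)) k,
    ← sum_mul_ite_rank (fun r => (Fintype.card F : ℂ) ^ r * ((Fintype.card F : ℂ) - 1)) (k + 1),
    ← sum_mul_ite_rank (fun r => (Fintype.card F : ℂ) ^ r) (k + 2),
    ← Finset.sum_add_distrib, ← Finset.sum_add_distrib]
  refine Finset.sum_congr rfl fun D _ => ?_
  simp only [Nat.add_right_cancel_iff, show D.1.rank + 1 = k + 2 ↔ D.1.rank = k + 1 by omega]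
  ring

variable {ψ : AddChar F ℂ}

theorem gauss_submatrix (e : ι ≃ κ) (b : F) (D : Matrix κ κ F) :
    gauss ψ b (D.submatrix e e) = gauss ψ b D := by
  refine Fintype.sum_equiv (Equiv.arrowCongr e (Equiv.refl F)) _ _ fun w => ?_
  congr 2
  rw [submatrix_mulVec_equiv]
  simp only [dotProduct]
  rw [← Equiv.sum_comp e]
  refine Finset.sum_congr rfl fun i _ => ?_
  simp [Function.comp_def]
  left
  rfl

theorem gaussFourier_submatrix (e : ι ≃ κ) (g : ℕ → ℂ) (b : F) (B : Matrix κ κ F) :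
    gaussFourier ψ g b (B.submatrix e e) = gaussFourier ψ g b B := by
  unfold gaussFourier
  rw [sum_symMat_equiv e.symm fun A => g A.rank * (ψ (trace (B * A)) * gauss ψ b A)]
  refine Finset.sum_congr rfl fun A _ => ?_
  rw [rank_submatrix, trace_submatrix_mul, gauss_submatrix]

/-- The sum of the Gauss sums of all symmetric matrices of rank `r`. -/
noncomputable def gaussCount (ψ : AddChar F ℂ) (b : F) (κ : Type*) [Fintype κ] [DecidableEq κ]
    (r : ℕ) : ℂ :=
  gaussFourier ψ (fun k => if k = r then 1 else 0) b (0 : Matrix κ κ F)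

theorem gaussCount_equiv (e : ι ≃ κ) (b : F) (r : ℕ) :
    gaussCount ψ b ι r = gaussCount ψ b κ r := by
  unfold gaussCount
  rw [← gaussFourier_submatrix e, submatrix_zero]
  rfl

theorem gaussFourier_mul_ite (h : ℕ → ℂ) (b : F) (k : ℕ) (B : Matrix κ κ F) :
    gaussFourier ψ (fun r => h r * (if r = k then 1 else 0)) b B
      = h k * gaussFourier ψ (fun r => if r = k then 1 else 0) b B := by
  unfold gaussFourier
  rw [Finset.mul_sum]
  refine Finset.sum_congr rfl fun A _ => ?_
  by_cases hk : A.1.rank = k <;> simp [hk]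

theorem gaussCount_border_zero (h2 : (2 : F) ≠ 0) (hψ : ψ.IsPrimitive) {b : F} (hb : b ≠ 0) :
    gaussCount ψ b (Unit ⊕ κ) 0 = Fintype.card F * gaussCount ψ b κ 0 := by
  have h := gaussFourier_mul_ite (ψ := ψ) (fun r => (Fintype.card F : ℂ) ^ (r + 1)) b 0
    (0 : Matrix κ κ F)
  rw [zero_add, pow_one] at h
  unfold gaussCount
  rw [gaussFourier_border_zero h2 hψ _ hb, ← h]
  simp [gaussFourier]

theorem gaussCount_border_add_two (h2 : (2 : F) ≠ 0) (hψ : ψ.IsPrimitive) {b : F} (hb : b ≠ 0)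
    (k : ℕ) : gaussCount ψ b (Unit ⊕ κ) (k + 2)
      = (Fintype.card F : ℂ) * ((Fintype.card F : ℂ) ^ Fintype.card κ - (Fintype.card F : ℂ) ^ k)
          * gaussCount ψ b κ k
        + (Fintype.card F : ℂ) ^ (k + 3) * gaussCount ψ b κ (k + 2) := by
  unfold gaussCount
  rw [gaussFourier_border_zero h2 hψ _ hb, ← gaussFourier_mul_ite (fun r => (Fintype.card F : ℂ)
      * ((Fintype.card F : ℂ) ^ Fintype.card κ - (Fintype.card F : ℂ) ^ r)) b k,
    ← gaussFourier_mul_ite (fun r => (Fintype.card F : ℂ) ^ (r + 1)) b (k + 2)]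
  unfold gaussFourier
  rw [← Finset.sum_add_distrib]
  refine Finset.sum_congr rfl fun A _ => ?_
  simp only [Nat.add_right_cancel_iff]
  ring

/-- The ratio of the numbers of symmetric matrices of ranks `2 * h + 1` and `2 * h`, and the average
Gauss sum of the symmetric matrices of rank `2 * h`. The two are proved by a joint induction on the
size. -/
theorem rankCount_odd_and_gaussCount_even (h2 : (2 : F) ≠ 0) (hψ : ψ.IsPrimitive) {b : F}
    (hb : b ≠ 0) (n h : ℕ) :
    (Fintype.card F : ℂ) ^ (2 * h) * rankCount F (Fin n) (2 * h + 1)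
        = ((Fintype.card F : ℂ) ^ n - (Fintype.card F : ℂ) ^ (2 * h)) * rankCount F (Fin n) (2 * h)
      ∧ (Fintype.card F : ℂ) ^ (2 * h) * gaussCount ψ b (Fin n) (2 * h)
        = (Fintype.card F : ℂ) ^ n * rankCount F (Fin n) (2 * h) := by
  induction n generalizing h with
  | zero =>
    have hr : ∀ A : SymMat F (Fin 0), A.1.rank = 0 := fun A => by
      simpa using A.1.rank_le_card_height
    have hS : ∀ k, k ≠ 0 → rankCount F (Fin 0) k = 0 := fun k hk => by
      simp [rankCount, hr, hk.symm]
    rcases Nat.eq_zero_or_pos h with rfl | hh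
    · rw [hS _ (by omega)]
      simp [gaussCount, gaussFourier, rankCount, hr, gauss]
    · rw [hS _ (by omega), hS _ (by omega)]
      simp [gaussCount, gaussFourier, hr, show 0 ≠ 2 * h by omega]
  | succ n ih =>
    let e : Unit ⊕ Fin n ≃ Fin (n + 1) := (Equiv.sumComm _ _).trans
      ((Equiv.sumCongr (Equiv.refl _) (Equiv.ofUnique Unit (Fin 1))).trans finSumFinEquiv)
    rw [← rankCount_equiv e, ← rankCount_equiv e, ← gaussCount_equiv e]
    rcases h with _ | h
    · obtain ⟨i1, j1⟩ := ih 0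
      simp only [mul_zero, zero_add, pow_zero, one_mul] at i1 j1 ⊢
      rw [rankCount_border_zero, rankCount_border_one, gaussCount_border_zero h2 hψ hb, i1, j1]
      constructor <;> ring
    · obtain ⟨i1, j1⟩ := ih h
      obtain ⟨i2, j2⟩ := ih (h + 1)
      rw [show 2 * (h + 1) + 1 = 2 * h + 1 + 2 by ring, show 2 * (h + 1) = 2 * h + 2 by ring,
        rankCount_border_add_two, rankCount_border_add_two, gaussCount_border_add_two h2 hψ hb,
        Fintype.card_fin]
      rw [show 2 * (h + 1) + 1 = 2 * h + 1 + 2 by ring, show 2 * (h + 1) = 2 * h + 2 by ring] at i2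
      rw [show 2 * (h + 1) = 2 * h + 2 by ring] at j2
      simp only [show 2 * h + 1 + 1 = 2 * h + 2 by ring]
      generalize (Fintype.card F : ℂ) = q at *
      constructor
      · linear_combination q ^ 3 * q ^ (2 * h) * i2 + (q * q ^ n - q ^ 2 * q ^ (2 * h)) * q * i1
      · linear_combination q ^ 3 * (q ^ n - q ^ (2 * h)) * j1 + q ^ 3 * q ^ (2 * h) * j2
          - q ^ 2 * (q - 1) * q ^ n * i1

/-- The number of symmetric matrices of positive even rank in terms of the next smaller size. -/
theorem rankCount_even (h2 : (2 : F) ≠ 0) (n h : ℕ) :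
    (rankCount F (Unit ⊕ Fin n) (2 * h + 2) : ℂ) = (Fintype.card F : ℂ) ^ (2 * h + 2)
      * (rankCount F (Fin n) (2 * h + 1) + rankCount F (Fin n) (2 * h + 2)) := by
  have hψ := AddChar.FiniteField.primitiveChar_to_Complex_isPrimitive F
  have h := (rankCount_odd_and_gaussCount_even h2 hψ one_ne_zero n h).1
  rw [rankCount_border_add_two, Fintype.card_fin]
  linear_combination - (Fintype.card F : ℂ) * h

/-- The indicator function of the integers at most `k`. -/
noncomputable def leInd (k : ℕ) : ℕ → ℂ := fun r => if r ≤ k then 1 else 0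

/-- The function `leInd k` jumps at `k` only, so that only blocks of rank `k` contribute. -/
theorem fourier_leInd_border (hψ : ψ.IsPrimitive) (k : ℕ) {b : F} (hb : b ≠ 0) (B : Matrix κ κ F) :
    (Fintype.card F : ℂ) ^ Fintype.card κ * fourier ψ (leInd k) (border b 0 B)
      = (Fintype.card F : ℂ) ^ k * gaussFourier ψ (fun r => if r = k then 1 else 0) b B := by
  rw [fourier_border hψ _ hb, ← gaussFourier_mul_ite (fun r => (Fintype.card F : ℂ) ^ r)]
  congr 1
  ext r
  congr 1
  unfold leInd
  split_ifs <;> first | omega | simp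

/-- The Fourier coefficient at a matrix of rank one. -/
theorem fourier_leInd_border_zero (h2 : (2 : F) ≠ 0) (hψ : ψ.IsPrimitive) (n h : ℕ) {b : F}
    (hb : b ≠ 0) :
    fourier ψ (leInd (2 * h)) (border b 0 (0 : Matrix (Fin n) (Fin n) F))
      = rankCount F (Fin n) (2 * h) := by
  have hq : (Fintype.card F : ℂ) ^ n ≠ 0 :=
    pow_ne_zero _ (Nat.cast_ne_zero.mpr Fintype.card_ne_zero)
  refine mul_left_cancel₀ hq ?_
  have h1 := fourier_leInd_border hψ (2 * h) hb (0 : Matrix (Fin n) (Fin n) F)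
  rw [Fintype.card_fin] at h1
  rw [h1]
  exact (rankCount_odd_and_gaussCount_even h2 hψ hb n h).2

theorem exists_equiv_sum_fin (i : κ) : ∃ n, Fintype.card κ = n + 1 ∧
    ∃ e : Unit ⊕ Fin n ≃ κ, e (Sum.inl ()) = i := by
  refine ⟨Fintype.card {j // j ≠ i}, ?_, ?_⟩
  · have := Fintype.card_pos_iff.mpr ⟨i⟩
    rw [Fintype.card_subtype_compl, Fintype.card_subtype_eq]
    omega
  · exact ⟨(Equiv.sumCongr (Equiv.ofUnique Unit {j // j = i}) (Fintype.equivFin _).symm).trans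
      (Equiv.sumCompl fun j => j = i), rfl⟩

omit [Fintype F] [Fintype κ] [Fintype ι] in
theorem diagonal_submatrix_eq_border (e : Unit ⊕ ι ≃ κ) (w : κ → F) :
    (diagonal w).submatrix e e
      = border (w (e (Sum.inl ()))) 0 (diagonal fun i => w (e (Sum.inr i))) := by
  rw [submatrix_diagonal_equiv]
  ext i j
  rcases i with i | i <;> rcases j with j | j <;> simp [border, diagonal_apply]

/-- The Fourier coefficients at nonzero `B` of the set of symmetric matrices of rank at most
`2 * h + 2` are bounded by the one at a matrix of rank one. -/
theorem norm_fourier_leInd_le (h2 : (2 : F) ≠ 0) (hψ : ψ.IsPrimitive) {n : ℕ} (h : ℕ)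
    {B : Matrix (Fin (n + 1)) (Fin (n + 1)) F} (hB : B.IsSymm) (hB0 : B ≠ 0) :
    ‖fourier ψ (leInd (2 * h + 2)) B‖ ≤ rankCount F (Fin n) (2 * h + 2) := by
  have hq : (Fintype.card F : ℂ) ≠ 0 := Nat.cast_ne_zero.mpr Fintype.card_ne_zero
  obtain ⟨P, hP, w, hw⟩ := exists_congr_diagonal h2 hB
  have hw0 : w ≠ 0 := by
    rintro rfl
    apply hB0
    have hu := (isUnit_iff_isUnit_det P).mpr hP
    have hu' := (isUnit_iff_isUnit_det Pᵀ).mpr (by rwa [det_transpose])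
    rw [show diagonal (0 : Fin (n + 1) → F) = 0 from diagonal_zero] at hw
    exact (hu'.mul_right_eq_zero).mp ((hu.mul_left_eq_zero).mp hw)
  obtain ⟨i, hi⟩ := Function.ne_iff.mp hw0
  obtain ⟨n', hn', e, he⟩ := exists_equiv_sum_fin i
  obtain rfl : n = n' := by simpa using hn'
  rw [← fourier_congr ψ _ _ hP, hw, ← fourier_submatrix ψ e, diagonal_submatrix_eq_border, he]
  rw [Pi.zero_apply] at hi
  generalize (fun k => w (e (Sum.inr k))) = w'
  by_cases hw' : w' = 0
  · subst hw'
    rw [show diagonal (0 : Fin n → F) = 0 from diagonal_zero,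
      show 2 * h + 2 = 2 * (h + 1) by ring, fourier_leInd_border_zero h2 hψ _ _ hi]
    simp
  obtain ⟨j, hj⟩ := Function.ne_iff.mp hw'
  obtain ⟨k, hk, e', he'⟩ := exists_equiv_sum_fin j
  have hj' : -w' j ≠ 0 := neg_ne_zero.mpr hj
  have h1 := fourier_leInd_border hψ (2 * h + 2) hi (diagonal w')
  -- with this replacement the two entries span a hyperbolic plane and the Gauss sums cancel:
  -- in even rank the first diagonal entry may be replaced by the negative of the second one
  have h3 : gaussFourier ψ (fun r => if r = 2 * h + 2 then 1 else 0) (w i) (diagonal w')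
      = gaussFourier ψ (fun r => if r = 2 * h + 2 then 1 else 0) (-w' j) (diagonal w') := by
    refine Finset.sum_congr rfl fun A _ => ?_
    by_cases hr : A.1.rank = 2 * h + 2
    · rw [gauss_eq_gauss_of_even h2 hψ hi hj' A.2 (by rw [hr]; exact ⟨h + 1, by ring⟩)]
    · simp only [if_neg hr, zero_mul]
  have h4 := gaussFourier_border_neg h2 hψ (fun r => if r = 2 * h + 2 then 1 else 0) hj'
    (diagonal fun i => w' (e' (Sum.inr i)))
  rw [neg_neg, ← he', ← diagonal_submatrix_eq_border, gaussFourier_submatrix, he'] at h4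
  rw [h3, h4, Fintype.card_fin, Fintype.card_fin, ← hk, Fintype.card_fin, mul_left_comm] at h1
  have h5 := mul_left_cancel₀ (pow_ne_zero _ hq) h1
  have h6 := norm_fourier_le (ψ := ψ) (fun r => (if r = 2 * h + 2 then 1 else 0)
    + (if r + 1 = 2 * h + 2 then (1 : ℝ) else 0)) (fun r => by positivity)
    (diagonal fun i => w' (e' (Sum.inr i)))
  have h7 : ∑ A : SymMat F (Fin k), ((if A.1.rank = 2 * h + 2 then 1 else 0)
      + (if A.1.rank + 1 = 2 * h + 2 then (1 : ℝ) else 0))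
      = rankCount F (Fin k) (2 * h + 1) + rankCount F (Fin k) (2 * h + 2) := by
    rw [Finset.sum_add_distrib, Finset.sum_boole, Finset.sum_boole, add_comm]
    simp only [show ∀ r, r + 1 = 2 * h + 2 ↔ r = 2 * h + 1 by omega]
    rfl
  have h8 := rankCount_even (F := F) h2 k h
  rw [rankCount_equiv e'] at h8
  have h9 : (rankCount F (Fin n) (2 * h + 2) : ℝ) = (Fintype.card F : ℝ) ^ (2 * h + 2)
      * (rankCount F (Fin k) (2 * h + 1) + rankCount F (Fin k) (2 * h + 2)) := by
    exact_mod_cast h8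
  rw [h5, norm_mul, norm_pow, Complex.norm_natCast, h9, ← h7]
  refine mul_le_mul_of_nonneg_left ?_ (by positivity)
  refine le_trans (le_of_eq ?_) h6
  congr 2
  ext r
  split_ifs <;> simp

end Count

/-! ### Weights of linear functionals on the matrices of bounded rank -/

section Weight

variable {F : Type*} [Field F] [Fintype F]

/-- The number of symmetric matrices of rank at most `k`. -/
noncomputable def rankLeCount (F κ : Type*) [Field F] [Fintype F] [Fintype κ] (k : ℕ) : ℕ :=
  (Finset.univ.filter fun A : SymMat F κ => A.1.rank ≤ k).card

/-- The number of symmetric matrices of rank at most `k` on which the functional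
`A ↦ trace (B * A)` does not vanish. -/
noncomputable def weight {κ : Type*} [Fintype κ] (k : ℕ) (B : Matrix κ κ F) : ℕ :=
  (Finset.univ.filter fun A : SymMat F κ => A.1.rank ≤ k ∧ trace (B * A.1) ≠ 0).card

variable {κ : Type*} [Fintype κ]

theorem cast_rankLeCount (k : ℕ) :
    (rankLeCount F κ k : ℂ) = ∑ A : SymMat F κ, leInd k A.1.rank := by
  unfold rankLeCount leInd
  rw [Finset.card_filter]
  push_cast
  rfl

/-- Orthogonality of characters expresses weights through Fourier coefficients. -/
theorem weight_eq_sum_fourier {ψ : AddChar F ℂ} (hψ : ψ.IsPrimitive) (k : ℕ) (B : Matrix κ κ F) :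
    (Fintype.card F : ℂ) * weight k B = ((Fintype.card F : ℂ) - 1) * rankLeCount F κ k
      - ∑ c ∈ Finset.univ.erase (0 : F), fourier ψ (leInd k) (c • B) := by
  have h0 : fourier ψ (leInd k) ((0 : F) • B) = rankLeCount F κ k := by
    simp [cast_rankLeCount, fourier]
  have h1 : ∑ c : F, fourier ψ (leInd k) (c • B)
      = ∑ A : SymMat F κ, leInd k A.1.rank *
        (if trace (B * A.1) = 0 then (Fintype.card F : ℂ) else 0) := by
    unfold fourier
    rw [Finset.sum_comm]
    refine Finset.sum_congr rfl fun A _ => ?_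
    rw [← Finset.mul_sum]
    have := AddChar.sum_mulShift (trace (B * A.1)) hψ
    rw [Nat.cast_ite, Nat.cast_zero] at this
    rw [← this]
    simp [trace_smul]
  have h2 : (Fintype.card F : ℂ) * weight k B + ∑ c : F, fourier ψ (leInd k) (c • B)
      = (Fintype.card F : ℂ) * rankLeCount F κ k := by
    rw [h1, cast_rankLeCount]
    unfold weight leInd
    rw [Finset.card_filter]
    push_cast
    rw [Finset.mul_sum, Finset.mul_sum, ← Finset.sum_add_distrib]
    refine Finset.sum_congr rfl fun A _ => ?_
    by_cases ha : A.1.rank ≤ k <;> by_cases hb : trace (B * A.1) = 0 <;> simp [ha, hb]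
  rw [← Finset.add_sum_erase _ _ (Finset.mem_univ (0 : F)), h0] at h2
  linear_combination h2

theorem le_card_mul_weight (h2 : (2 : F) ≠ 0) {n : ℕ} (h : ℕ)
    {B : Matrix (Fin (n + 1)) (Fin (n + 1)) F} (hB : B.IsSymm) (hB0 : B ≠ 0) :
    ((Fintype.card F : ℝ) - 1) * (rankLeCount F (Fin (n + 1)) (2 * h + 2)
        - rankCount F (Fin n) (2 * h + 2)) ≤ Fintype.card F * weight (2 * h + 2) B := by
  have hψ := AddChar.FiniteField.primitiveChar_to_Complex_isPrimitive F
  have hw := weight_eq_sum_fourier hψ (2 * h + 2) B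
  set S := ∑ c ∈ Finset.univ.erase (0 : F),
    fourier (AddChar.FiniteField.primitiveChar_to_Complex F) (leInd (2 * h + 2)) (c • B)
  have hS : ‖S‖ ≤ ((Fintype.card F : ℝ) - 1) * rankCount F (Fin n) (2 * h + 2) := by
    refine (norm_sum_le _ _).trans ((Finset.sum_le_card_nsmul _ _ _ fun c hc =>
      norm_fourier_leInd_le h2 hψ h (hB.smul c)
        (smul_ne_zero (Finset.ne_of_mem_erase hc) hB0)).trans ?_)
    rw [Finset.card_erase_of_mem (Finset.mem_univ _), Finset.card_univ, nsmul_eq_mul,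
      Nat.cast_sub Fintype.card_pos, Nat.cast_one]
  have hre := (Complex.re_le_norm S).trans hS
  have h3 := congrArg Complex.re hw
  simp only [Complex.sub_re, Complex.mul_re, Complex.natCast_re, Complex.natCast_im, Complex.one_re,
    Complex.one_im, Complex.sub_im, mul_zero, sub_zero] at h3
  linarith

/-- The matrix unit attains the bound of `le_card_mul_weight`. -/
theorem card_mul_weight_single (h2 : (2 : F) ≠ 0) (n h : ℕ) :
    (Fintype.card F : ℂ) * weight (2 * h + 2)
        (diagonal (Pi.single 0 1) : Matrix (Fin (n + 1)) (Fin (n + 1)) F)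
      = ((Fintype.card F : ℂ) - 1) * (rankLeCount F (Fin (n + 1)) (2 * h + 2)
        - rankCount F (Fin n) (2 * h + 2)) := by
  have hψ := AddChar.FiniteField.primitiveChar_to_Complex_isPrimitive F
  obtain ⟨n', hn', e, he⟩ := exists_equiv_sum_fin (0 : Fin (n + 1))
  obtain rfl : n = n' := by simpa using hn'
  rw [weight_eq_sum_fourier hψ, Finset.sum_congr rfl
    (g := fun _ => (rankCount F (Fin n) (2 * h + 2) : ℂ)), Finset.sum_const,
    Finset.card_erase_of_mem (Finset.mem_univ _), Finset.card_univ, nsmul_eq_mul,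
    Nat.cast_sub Fintype.card_pos, Nat.cast_one]
  · ring
  · intro c hc
    rw [← diagonal_smul, ← fourier_submatrix _ e, diagonal_submatrix_eq_border, he]
    have hz : (fun i => (c • (Pi.single 0 1 : Fin (n + 1) → F)) (e (Sum.inr i))) = 0 := by
      ext i
      have hne : e (Sum.inr i) ≠ 0 := by
        rw [← he]
        exact fun h => Sum.inr_ne_inl (e.injective h)
      simp [hne]
    rw [hz, show diagonal (0 : Fin n → F) = 0 from diagonal_zero,
      show 2 * h + 2 = 2 * (h + 1) by ring]
    exact fourier_leInd_border_zero h2 hψ _ _ (by simpa using Finset.ne_of_mem_erase hc)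

omit [Fintype F] in
theorem trace_diagonal_single_mul [DecidableEq κ] (i : κ) (A : Matrix κ κ F) :
    trace (diagonal (Pi.single i 1) * A) = A i i := by
  simp [trace, diagonal_mul, Pi.single_apply]

theorem weight_single_pos (n k : ℕ) (hk : 0 < k) :
    0 < weight k (diagonal (Pi.single 0 1) : Matrix (Fin (n + 1)) (Fin (n + 1)) F) := by
  refine Finset.card_pos.mpr ⟨⟨diagonal (Pi.single 0 1), isSymm_diagonal _⟩,
    Finset.mem_filter.mpr ⟨Finset.mem_univ _, ?_, ?_⟩⟩
  · refine le_trans (le_of_eq_of_le (rank_diagonal _) ?_) hk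
    rw [Fintype.card_subtype]
    refine (Finset.card_le_card (t := {0}) fun i hi => ?_).trans (by simp)
    by_contra hne
    exact (Finset.mem_filter.mp hi).2 (Pi.single_eq_of_ne (by simpa using hne) 1)
  · rw [trace_diagonal_single_mul]
    simp

/-- Counting the borders of a block by the rank of the block. -/
theorem rankLeCount_succ (n h : ℕ) :
    (rankLeCount F (Fin (n + 1)) (2 * h + 2) : ℂ)
      = (Fintype.card F : ℂ) ^ (n + 1) * rankLeCount F (Fin n) (2 * h)
        + (Fintype.card F : ℂ) ^ (2 * h + 2) * (rankCount F (Fin n) (2 * h + 1)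
          + rankCount F (Fin n) (2 * h + 2)) := by
  obtain ⟨n', hn', e, -⟩ := exists_equiv_sum_fin (0 : Fin (n + 1))
  obtain rfl : n = n' := by simpa using hn'
  have h1 := sum_mul_ite_rank (F := F) (κ := Fin n) (fun _ => (Fintype.card F : ℂ) ^ (2 * h + 2))
    (2 * h + 1)
  have h2 := sum_mul_ite_rank (F := F) (κ := Fin n) (fun _ => (Fintype.card F : ℂ) ^ (2 * h + 2))
    (2 * h + 2)
  rw [mul_add, ← h1, ← h2, cast_rankLeCount, cast_rankLeCount, sum_rank_equiv e.symm,
    sum_rank_border, Finset.mul_sum, ← Finset.sum_add_distrib, ← Finset.sum_add_distrib]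
  refine Finset.sum_congr rfl fun D _ => ?_
  unfold leInd
  rw [Fintype.card_fin]
  generalize D.1.rank = r
  have hcases : r ≤ 2 * h ∨ r = 2 * h + 1 ∨ r = 2 * h + 2 ∨ 2 * h + 2 < r := by omega
  rcases hcases with hr | hr | hr | hr
  · simp [hr, show r ≤ 2 * h + 2 by omega, show r ≤ 2 * h + 1 by omega,
      show r ≠ 2 * h + 1 by omega, show r ≠ 2 * h + 2 by omega]
    ring
  · subst hr
    simp
    ring
  · subst hr
    simp
  · simp [show ¬ r ≤ 2 * h by omega, show ¬ r ≤ 2 * h + 2 by omega, show ¬ r ≤ 2 * h + 1 by omega,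
      show r ≠ 2 * h + 1 by omega, show r ≠ 2 * h + 2 by omega]

end Weight

/-! ### The codes -/

section Codes

variable {F : Type*} [Field F] [Fintype F]

/-- The elements of the submodule `symm F m` are the symmetric matrices. -/
def symmEquiv (F : Type*) [Field F] (m : ℕ) : symm F m ≃ SymMat F (Fin m) where
  toFun A := ⟨A.1, A.2⟩
  invFun A := ⟨A.1, A.2⟩
  left_inv _ := rfl
  right_inv _ := rfl

theorem s_eq_rankCount (r m : ℕ) : s F r m = rankCount F (Fin m) r := by
  unfold s rankCount
  rw [← Fintype.card_subtype, ← Nat.card_eq_fintype_card]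
  exact Nat.card_congr ((symmEquiv F m).subtypeEquiv fun _ => Iff.rfl)

theorem ns_eq_rankLeCount (k m : ℕ) : ns F k m = rankLeCount F (Fin m) k := by
  unfold ns rankLeCount
  rw [← Fintype.card_subtype, ← Nat.card_eq_fintype_card]
  exact Nat.card_congr ((symmEquiv F m).subtypeEquiv fun _ => Iff.rfl)

omit [Fintype F] in
/-- In odd characteristic, each linear form agrees on symmetric matrices with the trace form of a
symmetric matrix. -/
theorem exists_isSymm_eval_eq_trace (h2 : (2 : F) ≠ 0) {m : ℕ}
    (f : MvPolynomial.homogeneousSubmodule (Fin m × Fin m) F 1) :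
    ∃ B : Matrix (Fin m) (Fin m) F, B.IsSymm ∧ ∀ A : symm F m,
      MvPolynomial.eval (fun ij => (A : Matrix (Fin m) (Fin m) F) ij.1 ij.2)
        (f : MvPolynomial (Fin m × Fin m) F) = trace (B * A.1) := by
  obtain ⟨f, hf⟩ := f
  dsimp only
  rw [MvPolynomial.homogeneousSubmodule_one_eq_span_X] at hf
  induction hf using Submodule.span_induction with
  | mem x hx =>
    obtain ⟨⟨i, j⟩, rfl⟩ := hx
    refine ⟨(2 : F)⁻¹ • (single i j 1 + single j i 1), ?_, fun A => ?_⟩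
    · refine IsSymm.smul ?_ _
      rw [IsSymm, transpose_add, transpose_single, transpose_single, add_comm]
    · have hA : A.1 j i = A.1 i j := A.2.apply i j
      rw [smul_mul, trace_smul, add_mul, trace_add, trace_single_mul, trace_single_mul, hA]
      simp
      field_simp
      ring
  | zero => exact ⟨0, isSymm_zero, fun A => by simp⟩
  | add f g _ _ ihf ihg =>
    obtain ⟨B, hB, hf⟩ := ihf
    obtain ⟨C, hC, hg⟩ := ihg
    exact ⟨B + C, hB.add hC, fun A => by rw [map_add, hf, hg, Matrix.add_mul, trace_add]⟩
  | smul c f _ ihf =>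
    obtain ⟨B, hB, hf⟩ := ihf
    exact ⟨c • B, hB.smul c, fun A => by
      rw [MvPolynomial.smul_eval, hf, smul_mul, trace_smul, smul_eq_mul]⟩

omit [Fintype F] in
theorem isMinDist_of_hammingNorm [DecidableEq F] {m n : ℕ} {P : Fin n → symm F m} {d : ℕ}
    (h : ∀ f, ev P f ≠ 0 → d ≤ hammingNorm (ev P f)) (f₀) (h0 : ev P f₀ ≠ 0)
    (hd : hammingNorm (ev P f₀) = d) : IsMinDist (code P) d := by
  constructor
  · exact ⟨ev P f₀, ⟨f₀, rfl⟩, 0, zero_mem _, h0, by rw [hammingDist_zero_right, hd]⟩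
  · rintro w ⟨_, ⟨f, rfl⟩, _, ⟨g, rfl⟩, hne, rfl⟩
    rw [hammingDist_eq_hammingNorm, ← map_neg, ← map_add]
    exact h _ (by rwa [map_add, map_neg, neg_add_eq_sub, sub_ne_zero, ne_comm])

theorem card_filter_of_isEnumeration {k m n : ℕ} {A : Fin n → symm F m}
    (hA : IsEnumeration A (rankLe F k m)) (B : Matrix (Fin m) (Fin m) F) :
    (Finset.univ.filter fun i => trace (B * (A i).1) ≠ 0).card = weight k B := by
  refine Finset.card_bij (fun i _ => symmEquiv F m (A i)) (fun i hi => ?_)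
    (fun i _ j _ h => hA.1 ((symmEquiv F m).injective h)) fun X hX => ?_
  · have hr : A i ∈ rankLe F k m := hA.2 ▸ Set.mem_range_self i
    exact Finset.mem_filter.mpr ⟨Finset.mem_univ _, hr, (Finset.mem_filter.mp hi).2⟩
  · obtain ⟨-, hr, ht⟩ := Finset.mem_filter.mp hX
    have : (symmEquiv F m).symm X ∈ Set.range A := hA.2 ▸ hr
    obtain ⟨i, hi⟩ := this
    refine ⟨i, Finset.mem_filter.mpr ⟨Finset.mem_univ _, ?_⟩, by rw [hi, Equiv.apply_symm_apply]⟩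
    rw [hi]
    exact ht

/-- Each projective point on which the functional does not vanish accounts for `q - 1` matrices. -/
theorem card_filter_of_isRepresentatives {k m n : ℕ} {P : Fin n → symm F m}
    (hP : IsRepresentatives P (det F k m)) (B : Matrix (Fin m) (Fin m) F) :
    (Fintype.card F - 1) * (Finset.univ.filter fun i => trace (B * (P i).1) ≠ 0).card
      = weight k B := by
  obtain ⟨hP0, hinj, hrange⟩ := hP
  rw [← Fintype.card_units, ← Finset.card_univ, ← Finset.card_product]
  refine Finset.card_bij (fun x _ => symmEquiv F m (x.1 • P x.2)) ?_ ?_ ?_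
  · rintro ⟨c, i⟩ hx
    obtain ⟨-, hi⟩ := Finset.mem_product.mp hx
    have hm : Projectivization.mk F (P i) (hP0 i) ∈ det F k m :=
      hrange ▸ Set.mem_range_self (f := fun i => Projectivization.mk F (P i) (hP0 i)) i
    obtain ⟨X, hX0, hX, hXi⟩ := hm
    obtain ⟨a, rfl⟩ := (Projectivization.mk_eq_mk_iff _ _ _ _ _).mp hXi
    refine Finset.mem_filter.mpr ⟨Finset.mem_univ _, ?_, ?_⟩
    · have h1 : ((a : F) • (P i).1).rank ≤ k := hX
      rw [rank_smul_of_mem_nonZeroDivisors _ (mem_nonZeroDivisors_of_ne_zero a.ne_zero)] at h1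
      change ((c : F) • (P i).1).rank ≤ k
      rwa [rank_smul_of_mem_nonZeroDivisors _ (mem_nonZeroDivisors_of_ne_zero c.ne_zero)]
    · change trace (B * ((c : F) • (P i).1)) ≠ 0
      rw [Matrix.mul_smul, trace_smul]
      exact smul_ne_zero c.ne_zero (Finset.mem_filter.mp hi).2
  · rintro ⟨c, i⟩ - ⟨c', j⟩ - h
    have h1 : c • P i = c' • P j := (symmEquiv F m).injective h
    obtain rfl : i = j := hinj ((Projectivization.mk_eq_mk_iff _ _ _ _ _).mpr
      ⟨c⁻¹ * c', by rw [mul_smul, ← h1, inv_smul_smul]⟩)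
    have h2 : (c : F) = c' := smul_left_injective F (hP0 i) h1
    rw [Units.ext h2]
  · intro X hX
    obtain ⟨-, hr, ht⟩ := Finset.mem_filter.mp hX
    have hX0 : (symmEquiv F m).symm X ≠ 0 := by
      intro h0
      have h1 : X.1 = 0 := congrArg Subtype.val h0
      exact ht (by rw [h1, Matrix.mul_zero, trace_zero])
    have hm : Projectivization.mk F _ hX0 ∈ det F k m := ⟨_, hX0, hr, rfl⟩
    rw [← hrange] at hm
    obtain ⟨i, hi⟩ := hm
    obtain ⟨c, hc⟩ := (Projectivization.mk_eq_mk_iff _ _ _ _ _).mp hi.symm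
    refine ⟨(c, i), Finset.mem_product.mpr ⟨Finset.mem_univ _, Finset.mem_filter.mpr
      ⟨Finset.mem_univ _, fun h0 => ht ?_⟩⟩, by simp only [hc, Equiv.apply_symm_apply]⟩
    have h1 : X.1 = (c : F) • (P i).1 := (congrArg Subtype.val hc).symm
    rw [h1, Matrix.mul_smul, trace_smul, h0, smul_zero]

/-- If the Hamming weights of the codewords are a fixed fraction of the weights of the corresponding
functionals, then the minimum distance is attained by the functional `A ↦ A₀₀`. -/
theorem exists_isMinDist [DecidableEq F] (h2 : (2 : F) ≠ 0) {n N : ℕ} (h a : ℕ) (ha : 0 < a)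
    {P : Fin N → symm F (n + 1)}
    (hP : ∀ B, a * (Finset.univ.filter fun i => trace (B * (P i).1) ≠ 0).card
      = weight (2 * h + 2) B) :
    ∃ d : ℕ, IsMinDist (code P) d ∧ (a * d : ℚ) = ((Fintype.card F : ℚ) - 1) *
      ((Fintype.card F : ℚ) ^ n * ns F (2 * h) n + (Fintype.card F : ℚ) ^ (2 * h + 1)
        * s F (2 * h + 1) n + ((Fintype.card F : ℚ) ^ (2 * h + 1) - (Fintype.card F : ℚ)⁻¹)
        * s F (2 * h + 2) n) := by
  have hq : (0 : ℝ) < Fintype.card F := Nat.cast_pos.mpr Fintype.card_pos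
  have hw0 := card_mul_weight_single h2 n h
  set E : Matrix (Fin (n + 1)) (Fin (n + 1)) F := diagonal (Pi.single 0 1) with hE
  let f₀ : MvPolynomial.homogeneousSubmodule (Fin (n + 1) × Fin (n + 1)) F 1 :=
    ⟨MvPolynomial.X (0, 0), MvPolynomial.isHomogeneous_X _ _⟩
  have hnorm : ∀ (f : MvPolynomial.homogeneousSubmodule (Fin (n + 1) × Fin (n + 1)) F 1) B,
      (∀ A : symm F (n + 1),
      MvPolynomial.eval (fun ij => (A : Matrix (Fin (n + 1)) (Fin (n + 1)) F) ij.1 ij.2)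
        (f : MvPolynomial (Fin (n + 1) × Fin (n + 1)) F) = trace (B * A.1)) →
      a * hammingNorm (ev P f) = weight (2 * h + 2) B := by
    intro f B hf
    rw [← hP B, hammingNorm]
    congr 2
    ext i
    simp only [Finset.mem_filter, Finset.mem_univ, true_and]
    rw [← hf]
    rfl
  have hf₀ := hnorm f₀ E fun A => by rw [hE, trace_diagonal_single_mul]; exact MvPolynomial.eval_X _
  have hpos := weight_single_pos (F := F) n (2 * h + 2) (by omega)
  rw [← hE] at hpos
  refine ⟨hammingNorm (ev P f₀), isMinDist_of_hammingNorm (fun f hf => ?_) f₀ ?_ rfl, ?_⟩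
  · obtain ⟨B, hB, hfB⟩ := exists_isSymm_eval_eq_trace h2 f
    have hB0 : B ≠ 0 := by
      rintro rfl
      refine hf (funext fun i => ?_)
      exact (hfB (P i)).trans (by simp)
    have h3 := le_card_mul_weight h2 h hB hB0
    have h4 : (Fintype.card F : ℝ) * weight (2 * h + 2) E
        = ((Fintype.card F : ℝ) - 1) * (rankLeCount F (Fin (n + 1)) (2 * h + 2)
          - rankCount F (Fin n) (2 * h + 2)) := by exact_mod_cast hw0
    rw [← h4] at h3
    have h5 := le_of_mul_le_mul_left h3 hq
    rw [← hnorm f B hfB, ← hf₀] at h5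
    exact le_of_mul_le_mul_left (by exact_mod_cast h5) ha
  · intro h0
    rw [h0, hammingNorm_zero, mul_zero] at hf₀
    omega
  · have hq' : (Fintype.card F : ℚ) ≠ 0 := Nat.cast_ne_zero.mpr Fintype.card_ne_zero
    have h5 : (Fintype.card F : ℚ) * weight (2 * h + 2) E
        = ((Fintype.card F : ℚ) - 1) * (rankLeCount F (Fin (n + 1)) (2 * h + 2)
          - rankCount F (Fin n) (2 * h + 2)) := by exact_mod_cast hw0
    have h6 : (rankLeCount F (Fin (n + 1)) (2 * h + 2) : ℚ)
        = (Fintype.card F : ℚ) ^ (n + 1) * rankLeCount F (Fin n) (2 * h)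
        + (Fintype.card F : ℚ) ^ (2 * h + 2) * (rankCount F (Fin n) (2 * h + 1)
          + rankCount F (Fin n) (2 * h + 2)) := by exact_mod_cast rankLeCount_succ (F := F) n h
    have h7 : (a * hammingNorm (ev P f₀) : ℚ) = weight (2 * h + 2) E := by exact_mod_cast hf₀
    rw [h7, s_eq_rankCount, s_eq_rankCount, ns_eq_rankLeCount]
    refine mul_left_cancel₀ hq' ?_
    rw [h5, h6]
    field_simp
    ring

end Codes
end SymmDet

theorem mainTheorem2 {F : Type*} [Field F] [Fintype F] [DecidableEq F]
    (q : ℕ) (hq : Fintype.card F = q) (hodd : Odd q)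
    (t m : ℕ) (ht : 0 < t) (htm : 2 * t ≤ m)
    (A : Fin (SymmDet.ns F (2 * t) m) → SymmDet.symm F m)
    (hA : SymmDet.IsEnumeration A (SymmDet.rankLe F (2 * t) m))
    (P : Fin (SymmDet.Ns F (2 * t) m) → SymmDet.symm F m)
    (hP : SymmDet.IsRepresentatives P (SymmDet.det F (2 * t) m)) :
    (∃ d : ℕ, SymmDet.IsMinDist (SymmDet.code A) d ∧
      (d : ℚ) = ((q : ℚ) - 1) *
        ((q : ℚ) ^ (m - 1) * SymmDet.ns F (2 * t - 2) (m - 1)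
          + (q : ℚ) ^ (2 * t - 1) * SymmDet.s F (2 * t - 1) (m - 1)
          + ((q : ℚ) ^ (2 * t - 1) - (q : ℚ)⁻¹) * SymmDet.s F (2 * t) (m - 1))) ∧
    (∃ d : ℕ, SymmDet.IsMinDist (SymmDet.code P) d ∧
      (d : ℚ) =
        (q : ℚ) ^ (m - 1) * SymmDet.ns F (2 * t - 2) (m - 1)
          + (q : ℚ) ^ (2 * t - 1) * SymmDet.s F (2 * t - 1) (m - 1)
          + ((q : ℚ) ^ (2 * t - 1) - (q : ℚ)⁻¹) * SymmDet.s F (2 * t) (m - 1)) := by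
  obtain ⟨h, rfl⟩ : ∃ h, t = h + 1 := ⟨t - 1, by omega⟩
  obtain ⟨n, rfl⟩ : ∃ n, m = n + 1 := ⟨m - 1, by omega⟩
  subst hq
  have h2 : (2 : F) ≠ 0 := by
    refine Ring.two_ne_zero fun hc => ?_
    exact Nat.not_even_iff_odd.mpr hodd (Nat.even_iff.mpr (FiniteField.even_card_of_char_two hc))
  have hcard : 1 < Fintype.card F := Fintype.one_lt_card
  simp only [show 2 * (h + 1) = 2 * h + 2 by ring, show 2 * h + 2 - 2 = 2 * h by omega,
    show 2 * h + 2 - 1 = 2 * h + 1 by omega, Nat.add_sub_cancel] at *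
  constructor
  · obtain ⟨d, hd, hd'⟩ := SymmDet.exists_isMinDist h2 h 1 one_pos (P := A) fun B => by
      rw [one_mul]
      convert SymmDet.card_filter_of_isEnumeration hA B
    exact ⟨d, hd, by simpa using hd'⟩
  · obtain ⟨d, hd, hd'⟩ := SymmDet.exists_isMinDist h2 h (Fintype.card F - 1) (by omega) (P := P)
      fun B => by convert SymmDet.card_filter_of_isRepresentatives hP B
    refine ⟨d, hd, ?_⟩
    rw [Nat.cast_sub hcard.le, Nat.cast_one] at hd'
    refine mul_left_cancel₀ (sub_ne_zero.mpr ?_) hd'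
    exact_mod_cast hcard.ne'
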